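/- Conventions. Let $D$ be a finitely generated abelian group and $S$ a commutative $D$-graded ring. A homogeneous $f\in S$ is called relevant if the degrees of the homogeneous units of the $D$-graded ring $S_f$ form a subgroup of finite index in $D$; $S_{(f)}$ denotes the degree-zero part of $S_f$. The multihomogeneous spectrum $\mathrm{Proj}_D S$ is the scheme obtained by gluing the affine schemes $D_+(f)=\mathrm{Spec}\,S_{(f)}$, for $f\in S$ relevant, along the open subschemes $D_+(fg)$. For a global section $s$ of an invertible sheaf on $X$, let $X_s\subseteq X$ be the open subset where $s$ does not vanish. Theorem. Let $R$ be a noetherian ring, $X$ a scheme of finite type over $R$, $\mathcal L_1,\dots,\mathcal L_r$ invertible sheaves on $X$, and $\delta\colon\mathbb Z^r\to D$ a surjective homomorphism of abelian groups. Let $\rho$ be the rank of $D$, and assume $\rho\ge 1$. For $1\le i\le\rho$ let $a_i\in\mathbb Z^r$ and let $\mathcal A_i$ be an invertible sheaf isomorphic to $\mathcal L^{a_i}=\mathcal L_1^{\otimes a_{i,1}}\otimes\cdots\otimes\mathcal L_r^{\otimes a_{i,r}}$. Assume: (1) the images of $\delta(a_1),\dots,\delta(a_\rho)$ form a $\mathbb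 Q$-basis of $\mathbb Q\otimes_{\mathbb Z} D$; (2) for every $1\le i\le\rho$ there are global sections $s_{i,1},\dots,s_{i,n_i}\in\Gamma(X,\mathcal A_i)$ and a subset $C_i\subseteq\{1,\dots,n_i\}$ such that the sets $X_{s_{i,v}}$, $v\in C_i$, form an affine open cover of $X$, and for every $v\in C_i$ the images $s_{i,u}/s_{i,v}$, $1\le u\le n_i$, generate $\Gamma(X_{s_{i,v}},\mathcal O_X)$ as an $R$-algebra. Let $R[T]=R[T_{i,u}\mid 1\le i\le\rho,\ 1\le u\le n_i]$ be the polynomial ring with the induced $D$-grading, in which $R$ has degree $0$ and $\deg T_{i,u}=\delta(a_i)$. Then $\mathrm{Proj}_D R[T]$ is separated, and there exists an immersion $X\hookrightarrow\mathrm{Proj}_D R[T]$ of schemes over $R$ (an isomorphism onto a closed subscheme of an open subscheme). This immersion is a closed immersion if $X$ is proper over $R$. -/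

import Mathlib

open CategoryTheory Limits AlgebraicGeometry
open scoped TensorProduct

universe u w

noncomputable section

namespace MultigradedProj

open HomogeneousLocalization SetLike

section Algebra

variable {D A : Type u} {σ : Type w} [AddCommGroup D] [CommRing A]
  [SetLike σ A] [AddSubgroupClass σ A]

/-- The elements of degree `d` of the localization `A_f` of a `D`-graded ring `A`: the fractions
`a / f ^ n` with `deg a - deg (f ^ n) = d`. -/
def awayPiece [DecidableEq D] (𝒜 : D → σ) [GradedRing 𝒜] (f : A) (d : D) :
    AddSubgroup (Localization.Away f) where
  carrier := {x | ∃ (n : ℕ) (e : D) (a : A), f ^ n ∈ 𝒜 e ∧ a ∈ 𝒜 (d + e) ∧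
    x * algebraMap A (Localization.Away f) (f ^ n) = algebraMap A (Localization.Away f) a}
  zero_mem' := ⟨0, 0, 0, by simpa using one_mem_graded 𝒜, zero_mem _, by simp⟩
  add_mem' := by
    rintro x y ⟨n, e, a, hf, ha, hx⟩ ⟨n', e', a', hf', ha', hy⟩
    refine ⟨n + n', e + e', a * f ^ n' + a' * f ^ n, ?_, add_mem ?_ ?_, ?_⟩
    · rw [pow_add]; exact mul_mem_graded hf hf'
    · rw [← add_assoc]; exact mul_mem_graded ha hf'
    · rw [add_comm e, ← add_assoc]; exact mul_mem_graded ha' hf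
    · rw [pow_add, map_add, map_mul, map_mul, map_mul, ← hx, ← hy]; ring
  neg_mem' := by
    rintro x ⟨n, e, a, hf, ha, hx⟩
    exact ⟨n, e, -a, hf, neg_mem ha, by rw [map_neg, ← hx, neg_mul]⟩

/-- A family of additive subgroups `ℬ d` (the homogeneous pieces of a `D`-graded ring `B`) is
periodic if the degrees of the homogeneous units of `B` form a subgroup of finite index of `D`. -/
def IsPeriodic {B : Type u} [CommRing B] (ℬ : D → AddSubgroup B) : Prop :=
  (AddSubgroup.closure {d : D | ∃ u : Bˣ, (u : B) ∈ ℬ d}).FiniteIndex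

variable [DecidableEq D] (𝒜 : D → σ) [GradedRing 𝒜]

/-- An element `f` of a `D`-graded ring is relevant if it is homogeneous and the localization
`A_f` is periodic. -/
structure IsRelevant (f : A) : Prop where
  homogeneous : SetLike.IsHomogeneousElem 𝒜 f
  periodic : IsPeriodic (awayPiece 𝒜 f)

variable {𝒜}

lemma awayPiece_mul {f : A} {d e : D} {x y : Localization.Away f} (hx : x ∈ awayPiece 𝒜 f d)
    (hy : y ∈ awayPiece 𝒜 f e) : x * y ∈ awayPiece 𝒜 f (d + e) := by
  obtain ⟨n, i, a, hf, ha, hx⟩ := hx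
  obtain ⟨m, j, b, hf', hb, hy⟩ := hy
  refine ⟨n + m, i + j, a * b, ?_, ?_, ?_⟩
  · rw [pow_add]; exact mul_mem_graded hf hf'
  · rw [add_add_add_comm]; exact mul_mem_graded ha hb
  · rw [pow_add, map_mul, map_mul, ← hx, ← hy]; ring

lemma algebraMap_mem_awayPiece {f a : A} {d : D} (ha : a ∈ 𝒜 d) :
    algebraMap A (Localization.Away f) a ∈ awayPiece 𝒜 f d :=
  ⟨0, 0, a, by simpa using one_mem_graded 𝒜, by simpa using ha, by simp⟩

lemma one_mem_awayPiece (f : A) : 1 ∈ awayPiece 𝒜 f 0 := by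
  simpa using algebraMap_mem_awayPiece (f := f) (one_mem_graded 𝒜)

lemma awayPiece_pow {f : A} {d : D} {x : Localization.Away f} (hx : x ∈ awayPiece 𝒜 f d) (n : ℕ) :
    x ^ n ∈ awayPiece 𝒜 f (n • d) := by
  induction n with
  | zero => simpa using one_mem_awayPiece f
  | succ n ih => rw [pow_succ, succ_nsmul]; exact awayPiece_mul ih hx

lemma mem_awayPiece_zero {f : A} {x : Localization.Away f} (hx : x ∈ awayPiece 𝒜 f 0) :
    ∃ y : Away 𝒜 f, y.val = x := by
  obtain ⟨n, e, a, hf, ha, hx⟩ := hx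
  rw [zero_add] at ha
  refine ⟨HomogeneousLocalization.mk ⟨e, ⟨a, ha⟩, ⟨f ^ n, hf⟩, ⟨n, rfl⟩⟩, ?_⟩
  rw [val_mk, Localization.mk_eq_mk'_apply, IsLocalization.mk'_eq_iff_eq_mul]
  exact hx.symm

lemma val_mem_awayPiece {f : A} (y : Away 𝒜 f) : y.val ∈ awayPiece 𝒜 f 0 := by
  obtain ⟨⟨e, ⟨a, ha⟩, ⟨b, hb⟩, ⟨n, (rfl : _ = b)⟩⟩, rfl⟩ := mk_surjective y
  refine ⟨n, e, a, hb, by simpa using ha, ?_⟩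
  rw [val_mk, Localization.mk_eq_mk'_apply]
  exact IsLocalization.mk'_spec (M := .powers f) _ a ⟨f ^ n, n, rfl⟩

/-- The inverse of a homogeneous unit is homogeneous. -/
lemma inv_mem_awayPiece {f : A} (hf : IsHomogeneousElem 𝒜 f) {d : D}
    (u : (Localization.Away f)ˣ) (hu : (u : Localization.Away f) ∈ awayPiece 𝒜 f d) :
    ((u⁻¹ : (Localization.Away f)ˣ) : Localization.Away f) ∈ awayPiece 𝒜 f (-d) := by
  obtain ⟨δ, hδ⟩ := hf
  have hpow (n : ℕ) : f ^ n ∈ 𝒜 (n • δ) := pow_mem_graded n hδ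
  obtain ⟨n, e, b, hne, hb, hub⟩ := hu
  obtain ⟨⟨c, ⟨_, j, rfl⟩⟩, hc⟩ := IsLocalization.surj (Submonoid.powers f)
    ((u⁻¹ : (Localization.Away f)ˣ) : Localization.Away f)
  simp only at hc
  have h1 : algebraMap A (Localization.Away f) (b * c) =
      algebraMap A (Localization.Away f) (f ^ n * f ^ j) := by
    rw [map_mul, ← hub, ← hc, map_mul]
    have := u.mul_inv
    linear_combination (algebraMap A (Localization.Away f) (f ^ n) *
      algebraMap A (Localization.Away f) (f ^ j)) * this
  obtain ⟨⟨_, t, rfl⟩, ht⟩ := (IsLocalization.eq_iff_exists (Submonoid.powers f) _).mp h1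
  simp only at ht
  -- the component of `c` of the right degree
  set γ : D := j • δ + -d with hγ
  have hb' : f ^ t * b ∈ 𝒜 (t • δ + (d + e)) := mul_mem_graded (hpow t) hb
  have h2 : f ^ t * b * (DirectSum.decompose 𝒜 c γ : A) = f ^ t * (f ^ n * f ^ j) := by
    rw [← DirectSum.coe_decompose_mul_add_of_left_mem 𝒜 hb', mul_assoc, ht]
    apply DirectSum.decompose_of_mem_same
    have : t • δ + (d + e) + γ = t • δ + (e + j • δ) := by rw [hγ]; abel
    rw [this]
    exact mul_mem_graded (hpow t) (mul_mem_graded hne (hpow j))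
  refine ⟨j, j • δ, DirectSum.decompose 𝒜 c γ, hpow j, ?_, ?_⟩
  · rw [add_comm]; exact (DirectSum.decompose 𝒜 c γ).2
  · have hfu : IsUnit (algebraMap A (Localization.Away f) f) :=
      IsLocalization.Away.algebraMap_isUnit f
    have h3 := congr(algebraMap A (Localization.Away f) $h2)
    simp only [map_mul, map_pow] at h3 hub
    rw [← hub] at h3
    have hcan : IsUnit (algebraMap A (Localization.Away f) f ^ t *
      algebraMap A (Localization.Away f) f ^ n * (u : Localization.Away f)) :=
      ((hfu.pow t).mul (hfu.pow n)).mul u.isUnit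
    apply hcan.mul_left_cancel
    simp only [map_pow]
    have := u.mul_inv
    linear_combination (algebraMap A (Localization.Away f) f ^ t *
      algebraMap A (Localization.Away f) f ^ n * algebraMap A (Localization.Away f) f ^ j) * this
      - h3

/-- If `f` is relevant then every degree has a positive multiple that is the degree of
a homogeneous unit of `A_f`. -/
lemma IsRelevant.exists_unit {f : A} (hf : IsRelevant 𝒜 f) (e : D) :
    ∃ m : ℕ, 0 < m ∧ ∃ u : (Localization.Away f)ˣ,
      (u : Localization.Away f) ∈ awayPiece 𝒜 f (m • e) := by
  have := hf.periodic
  rw [IsPeriodic] at this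
  refine ⟨_, Nat.pos_of_ne_zero this.index_ne_zero, ?_⟩
  have hmem := AddSubgroup.nsmul_index_mem
    (AddSubgroup.closure {d : D | ∃ u : (Localization.Away f)ˣ,
      (u : Localization.Away f) ∈ awayPiece 𝒜 f d}) e
  refine AddSubgroup.closure_induction (p := fun d _ ↦ ∃ u : (Localization.Away f)ˣ,
      (u : Localization.Away f) ∈ awayPiece 𝒜 f d) (fun _ h ↦ h) ?_ ?_ ?_ hmem
  · exact ⟨1, one_mem_awayPiece f⟩
  · rintro x y - - ⟨u, hu⟩ ⟨v, hv⟩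
    exact ⟨u * v, awayPiece_mul hu hv⟩
  · rintro x - ⟨u, hu⟩
    exact ⟨u⁻¹, inv_mem_awayPiece hf.homogeneous u hu⟩

/-- For `f ∣ x` the canonical map `A_f → A_x`. -/
def locMap {f x : A} (h : f ∣ x) : Localization.Away f →+* Localization.Away x :=
  Localization.awayLift (algebraMap A _) _
    (isUnit_of_dvd_unit (map_dvd _ h) (IsLocalization.Away.algebraMap_isUnit x))

@[simp]
lemma locMap_algebraMap {f x : A} (h : f ∣ x) (a : A) :
    locMap h (algebraMap A _ a) = algebraMap A _ a :=
  IsLocalization.Away.lift_eq _ (isUnit_of_dvd_unit (map_dvd _ h)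
    (IsLocalization.Away.algebraMap_isUnit x)) a

lemma locMap_mem {f g x : A} (hx : x = f * g) (hg : IsHomogeneousElem 𝒜 g) {d : D}
    {y : Localization.Away f} (hy : y ∈ awayPiece 𝒜 f d) :
    locMap ⟨g, hx⟩ y ∈ awayPiece 𝒜 x d := by
  obtain ⟨n, e, a, hf, ha, hy⟩ := hy
  obtain ⟨ε, hg⟩ := hg
  refine ⟨n, e + n • ε, a * g ^ n, ?_, ?_, ?_⟩
  · rw [hx, mul_pow]; exact mul_mem_graded hf (pow_mem_graded n hg)
  · rw [← add_assoc]; exact mul_mem_graded ha (pow_mem_graded n hg)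
  · have := congr(locMap ⟨g, hx⟩ $hy)
    rw [map_mul, locMap_algebraMap, locMap_algebraMap] at this
    have hxn : x ^ n = f ^ n * g ^ n := by rw [hx, mul_pow]
    rw [hxn, map_mul, map_mul, ← this]; ring

lemma IsRelevant.mul {f g : A} (hf : IsRelevant 𝒜 f) (hg : IsHomogeneousElem 𝒜 g) :
    IsRelevant 𝒜 (f * g) where
  homogeneous := hf.homogeneous.mul hg
  periodic := by
    have := hf.periodic
    rw [IsPeriodic] at this ⊢
    refine AddSubgroup.finiteIndex_of_le (H := AddSubgroup.closure
      {d : D | ∃ u : (Localization.Away f)ˣ, (u : Localization.Away f) ∈ awayPiece 𝒜 f d})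
      (AddSubgroup.closure_mono ?_)
    rintro d ⟨u, hu⟩
    exact ⟨Units.map (locMap ⟨g, rfl⟩).toMonoidHom u, locMap_mem rfl hg hu⟩

lemma val_awayMap_eq {f g x : A} {e : D} (hg : g ∈ 𝒜 e) (hx : x = f * g) (y : Away 𝒜 f) :
    (awayMap 𝒜 hg hx y).val = locMap ⟨g, hx⟩ y.val :=
  val_awayMap 𝒜 hg hx y

/-- If `h = g ^ m / u` for a homogeneous unit `u` of `A_f`, then `A_(fg) = A_(f)[1 / h]`. -/
lemma isLocalization_awayMap {f g x : A} {d e : D} (hf : f ∈ 𝒜 d) (hg : g ∈ 𝒜 e)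
    (hx : x = f * g) (h : Away 𝒜 f) {m : ℕ} (hm : 0 < m) (u : (Localization.Away f)ˣ)
    (hu : (u : Localization.Away f) ∈ awayPiece 𝒜 f (m • e))
    (huh : (u : Localization.Away f) * h.val = algebraMap A _ (g ^ m)) :
    letI := (awayMap 𝒜 hg hx).toAlgebra
    IsLocalization.Away h (Away 𝒜 x) := by
  let := (awayMap 𝒜 hg hx).toAlgebra
  have hgh : IsHomogeneousElem 𝒜 g := ⟨e, hg⟩
  have hxn (n : ℕ) : x ^ n = f ^ n * g ^ n := by rw [hx, mul_pow]
  have hxmem : x ∈ 𝒜 (d + e) := hx ▸ mul_mem_graded hf hg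
  have hdvd : f ∣ x := ⟨g, hx⟩
  have hux : IsUnit (algebraMap A (Localization.Away x) x) :=
    IsLocalization.Away.algebraMap_isUnit x
  have hfu : IsUnit (algebraMap A (Localization.Away x) f) :=
    isUnit_of_dvd_unit (map_dvd _ hdvd) hux
  have hgu : IsUnit (algebraMap A (Localization.Away x) g) :=
    isUnit_of_dvd_unit (map_dvd _ ⟨f, by rw [hx, mul_comm]⟩) hux
  have hff : IsUnit (algebraMap A (Localization.Away f) f) :=
    IsLocalization.Away.algebraMap_isUnit f
  -- inverse of `g` in `A_x`
  obtain ⟨γ, hγ⟩ := hgu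
  have hγinv : ((γ⁻¹ : (Localization.Away x)ˣ) : Localization.Away x) ∈ awayPiece 𝒜 x (-e) :=
    inv_mem_awayPiece ⟨_, hxmem⟩ γ (hγ ▸ algebraMap_mem_awayPiece hg)
  have hval (y : Away 𝒜 f) : (algebraMap (Away 𝒜 f) (Away 𝒜 x) y).val = locMap hdvd y.val :=
    val_awayMap_eq hg hx y
  constructor; constructor
  · rintro ⟨_, n, rfl⟩
    rw [map_pow]
    refine IsUnit.pow _ ?_
    obtain ⟨z, hz⟩ := mem_awayPiece_zero (𝒜 := 𝒜) (f := x)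
      (x := locMap hdvd u * ((γ⁻¹ : (Localization.Away x)ˣ) : Localization.Away x) ^ m) (by
        have := awayPiece_mul (locMap_mem hx hgh hu) (awayPiece_pow hγinv m)
        rwa [smul_neg, add_neg_cancel] at this)
    refine isUnit_iff_exists_inv.mpr ⟨z, ?_⟩
    ext
    rw [val_mul, hval, hz, val_one]
    have h1 := congr(locMap hdvd $huh)
    rw [map_mul, locMap_algebraMap, map_pow, ← hγ] at h1
    have h2 : (γ : Localization.Away x) ^ m *
        ((γ⁻¹ : (Localization.Away x)ˣ) : Localization.Away x) ^ m = 1 := by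
      rw [← mul_pow, γ.mul_inv, one_pow]
    linear_combination ((γ⁻¹ : (Localization.Away x)ˣ) : Localization.Away x) ^ m * h1 + h2
  · intro z
    obtain ⟨n, s, hs, rfl⟩ := Away.mk_surjective 𝒜 hxmem z
    obtain ⟨φ, hφ⟩ := hff
    have hφinv : ((φ⁻¹ : (Localization.Away f)ˣ) : Localization.Away f) ∈ awayPiece 𝒜 f (-d) :=
      inv_mem_awayPiece ⟨_, hf⟩ φ (hφ ▸ algebraMap_mem_awayPiece hf)
    obtain ⟨t, ht⟩ := mem_awayPiece_zero (𝒜 := 𝒜) (f := f)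
      (x := algebraMap A _ (s * g ^ ((m - 1) * n)) *
        (((φ⁻¹ : (Localization.Away f)ˣ) : Localization.Away f) ^ n *
        ((u⁻¹ : (Localization.Away f)ˣ) : Localization.Away f) ^ n)) (by
        have h1 := awayPiece_mul (algebraMap_mem_awayPiece (f := f)
          (mul_mem_graded hs (pow_mem_graded ((m - 1) * n) hg)))
          (awayPiece_mul (awayPiece_pow hφinv n)
            (awayPiece_pow (inv_mem_awayPiece ⟨_, hf⟩ u hu) n))
        convert! h1 using 1
        obtain ⟨m, rfl⟩ : ∃ k, m = k + 1 := ⟨m - 1, by omega⟩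
        simp only [Nat.add_sub_cancel, add_smul, smul_add, mul_smul, one_smul, smul_neg]
        rw [smul_comm n m e]
        abel_nf)
    refine ⟨⟨t, ⟨_, n, rfl⟩⟩, ?_⟩
    change Away.mk 𝒜 hxmem n s hs * algebraMap (Away 𝒜 f) (Away 𝒜 x) (h ^ n) =
      algebraMap (Away 𝒜 f) (Away 𝒜 x) t
    ext
    rw [val_mul, hval, hval, ht, val_pow, map_pow]
    have hz : (Away.mk 𝒜 hxmem n s hs).val * algebraMap A _ (x ^ n) = algebraMap A _ s := by
      rw [Away.val_mk, Localization.mk_eq_mk'_apply]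
      exact IsLocalization.mk'_spec (M := .powers x) _ s ⟨x ^ n, n, rfl⟩
    have h1 := congr(locMap hdvd $huh)
    rw [map_mul, locMap_algebraMap, map_pow] at h1
    have hu1 : locMap hdvd u * locMap hdvd ((u⁻¹ : (Localization.Away f)ˣ) : _) = 1 := by
      rw [← map_mul, u.mul_inv, map_one]
    have hφ1 : algebraMap A (Localization.Away x) f *
        locMap hdvd ((φ⁻¹ : (Localization.Away f)ˣ) : _) = 1 := by
      rw [← locMap_algebraMap hdvd, ← hφ, ← map_mul, φ.mul_inv, map_one]
    have h2 : locMap hdvd h.val = algebraMap A (Localization.Away x) g ^ m *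
        locMap hdvd ((u⁻¹ : (Localization.Away f)ˣ) : _) := by
      rw [← h1]; linear_combination (- locMap hdvd h.val) * hu1
    have hgm : algebraMap A (Localization.Away x) g ^ m =
        algebraMap A (Localization.Away x) g ^ (m - 1) * algebraMap A (Localization.Away x) g := by
      rw [← pow_succ]; congr 1; omega
    rw [h2, map_mul, locMap_algebraMap, map_mul, map_mul, map_pow, map_pow, map_pow, ← hz,
      hxn, map_mul, map_pow, map_pow, hgm, pow_mul]
    generalize (Away.mk 𝒜 hxmem n s hs).val = z
    have hφn : algebraMap A (Localization.Away x) f ^ n *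
        locMap hdvd ((φ⁻¹ : (Localization.Away f)ˣ) : _) ^ n = 1 := by
      rw [← mul_pow, hφ1, one_pow]
    rw [mul_pow, mul_pow]
    linear_combination (-z * algebraMap A (Localization.Away x) g ^ n *
      (algebraMap A (Localization.Away x) g ^ (m - 1)) ^ n *
      locMap hdvd ((u⁻¹ : (Localization.Away f)ˣ) : _) ^ n) * hφn
  · intro y₁ y₂ hy
    have hy' := congr(($hy).val)
    rw [hval, hval] at hy'
    obtain ⟨n₁, a₁, ha₁, rfl⟩ := Away.mk_surjective 𝒜 hf y₁
    obtain ⟨n₂, a₂, ha₂, rfl⟩ := Away.mk_surjective 𝒜 hf y₂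
    set z₁ := (Away.mk 𝒜 hf n₁ a₁ ha₁).val with hz₁
    set z₂ := (Away.mk 𝒜 hf n₂ a₂ ha₂).val with hz₂
    have e₁ : z₁ * algebraMap A _ (f ^ n₁) = algebraMap A _ a₁ := by
      rw [hz₁, Away.val_mk, Localization.mk_eq_mk'_apply]
      exact IsLocalization.mk'_spec (M := .powers f) _ a₁ ⟨f ^ n₁, n₁, rfl⟩
    have e₂ : z₂ * algebraMap A _ (f ^ n₂) = algebraMap A _ a₂ := by
      rw [hz₂, Away.val_mk, Localization.mk_eq_mk'_apply]
      exact IsLocalization.mk'_spec (M := .powers f) _ a₂ ⟨f ^ n₂, n₂, rfl⟩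
    have h1 : algebraMap A (Localization.Away x) (a₁ * f ^ n₂) =
        algebraMap A (Localization.Away x) (a₂ * f ^ n₁) := by
      have e₁' := congr(locMap hdvd $e₁)
      have e₂' := congr(locMap hdvd $e₂)
      rw [map_mul, locMap_algebraMap, locMap_algebraMap] at e₁' e₂'
      rw [map_mul, map_mul, ← e₁', ← e₂', hy']
      ring
    obtain ⟨⟨_, k, rfl⟩, hk⟩ := (IsLocalization.eq_iff_exists (Submonoid.powers x) _).mp h1
    simp only [hxn] at hk
    -- `g ^ k` kills the difference in `A_f`
    have h3 : algebraMap A (Localization.Away f) g ^ k * z₁ =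
        algebraMap A (Localization.Away f) g ^ k * z₂ := by
      have h4 := congr(algebraMap A (Localization.Away f) $hk)
      simp only [map_mul, ← e₁, ← e₂, map_pow] at h4
      apply (((hff.pow k).mul (hff.pow n₁)).mul (hff.pow n₂)).mul_left_cancel
      linear_combination h4
    refine ⟨⟨_, k, rfl⟩, ?_⟩
    ext
    simp only [val_mul, val_pow]
    have h5 : h.val = ((u⁻¹ : (Localization.Away f)ˣ) : Localization.Away f) *
        algebraMap A _ g ^ m := by
      rw [← map_pow, ← huh, ← mul_assoc, u.inv_mul, one_mul]
    have h6 : h.val ^ k = ((u⁻¹ : (Localization.Away f)ˣ) : Localization.Away f) ^ k *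
        (algebraMap A _ g ^ ((m - 1) * k)) * algebraMap A _ g ^ k := by
      rw [h5, mul_pow, ← pow_mul, mul_assoc, ← pow_add]
      congr 2
      obtain ⟨m, rfl⟩ : ∃ j, m = j + 1 := ⟨m - 1, by omega⟩
      simp [add_mul]
    rw [h6, mul_assoc, h3, ← mul_assoc]

end Algebra

section Gluing

variable {D A : Type u} {σ : Type w} [AddCommGroup D] [CommRing A]
  [SetLike σ A] [AddSubgroupClass σ A] [DecidableEq D] (𝒜 : D → σ) [GradedRing 𝒜]

/-- The relevant elements, preordered by reverse divisibility with homogeneous quotient: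
`x ≤ f` if `x = f * g` with `g` homogeneous (so that `D₊(x) ⊆ D₊(f)`). -/
structure RelevantElement where
  elt : A
  relevant : IsRelevant 𝒜 elt

instance : Preorder (RelevantElement 𝒜) where
  le x f := ∃ g : A, IsHomogeneousElem 𝒜 g ∧ x.elt = f.elt * g
  le_refl f := ⟨1, ⟨0, one_mem_graded 𝒜⟩, by simp⟩
  le_trans := by
    rintro x y z ⟨g, hg, h⟩ ⟨g', hg', h'⟩
    exact ⟨g' * g, hg'.mul hg, by rw [h, h', mul_assoc]⟩

variable {𝒜} in
/-- The canonical map `A_(f) → A_(x)` for `x = f * g`. -/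
def transition {x f : RelevantElement 𝒜} (h : x ≤ f) : Away 𝒜 f.elt →+* Away 𝒜 x.elt :=
  awayMap 𝒜 h.choose_spec.1.choose_spec h.choose_spec.2

variable {𝒜} in
lemma RelevantElement.dvd {x f : RelevantElement 𝒜} (h : x ≤ f) : f.elt ∣ x.elt :=
  ⟨h.choose, h.choose_spec.2⟩

variable {𝒜} in
lemma val_transition {x f : RelevantElement 𝒜} (h : x ≤ f) (y : Away 𝒜 f.elt) :
    (transition h y).val = locMap (RelevantElement.dvd h) y.val :=
  val_awayMap_eq _ _ _

variable {𝒜} in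
lemma transition_eq {x f : RelevantElement 𝒜} (h : x ≤ f) {e : D} {g : A} (hg : g ∈ 𝒜 e)
    (hx : x.elt = f.elt * g) : transition h = awayMap 𝒜 hg hx := by
  ext y
  rw [val_transition, val_awayMap_eq]

lemma locMap_self {f : A} (h : f ∣ f) (y : Localization.Away f) : locMap h y = y := by
  have : locMap h = RingHom.id _ :=
    IsLocalization.ringHom_ext (Submonoid.powers f) (by ext a; simp)
  rw [this, RingHom.id_apply]

lemma locMap_locMap {f g x : A} (h : f ∣ g) (h' : g ∣ x) (y : Localization.Away f) :
    locMap h' (locMap h y) = locMap (h.trans h') y := by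
  have : (locMap h').comp (locMap h) = locMap (h.trans h') :=
    IsLocalization.ringHom_ext (Submonoid.powers f) (by ext a; simp)
  rw [← this, RingHom.comp_apply]

variable {𝒜} in
lemma transition_id {f : RelevantElement 𝒜} (h : f ≤ f) : transition h = RingHom.id _ := by
  ext y
  rw [val_transition, locMap_self, RingHom.id_apply]

variable {𝒜} in
lemma transition_comp {x y z : RelevantElement 𝒜} (h : x ≤ y) (h' : y ≤ z) :
    (transition h).comp (transition h') = transition (h.trans h') := by
  ext a
  rw [RingHom.comp_apply, val_transition, val_transition, val_transition, locMap_locMap]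

/-- For each homogeneous `g` there is `h ∈ A_(f)` cutting out `D₊(f * g)` in `D₊(f)`,
compatibly with further localization. -/
lemma exists_isLocalization (f : RelevantElement 𝒜) {e : D} {g : A} (hg : g ∈ 𝒜 e) :
    ∃ h : Away 𝒜 f.elt, ∀ (i l : RelevantElement 𝒜) (hi : i ≤ f) (hl : l ≤ i)
      (_ : l.elt = i.elt * g), letI := (transition hl).toAlgebra
      IsLocalization.Away (transition hi h) (Away 𝒜 l.elt) := by
  obtain ⟨m, hm, u, hu⟩ := f.relevant.exists_unit e
  obtain ⟨h, hh⟩ := mem_awayPiece_zero (𝒜 := 𝒜) (f := f.elt)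
    (x := ((u⁻¹ : (Localization.Away f.elt)ˣ) : Localization.Away f.elt) *
      algebraMap A _ (g ^ m)) (by
      have := awayPiece_mul (inv_mem_awayPiece f.relevant.homogeneous u hu)
        (algebraMap_mem_awayPiece (f := f.elt) (pow_mem_graded m hg))
      rwa [neg_add_cancel] at this)
  refine ⟨h, fun i l hi hl hlg ↦ ?_⟩
  obtain ⟨d, hd⟩ := i.relevant.homogeneous
  obtain ⟨a, ha, hia⟩ := id hi
  rw [transition_eq hl hg hlg]
  refine isLocalization_awayMap hd hg hlg _ hm
    (Units.map (locMap (RelevantElement.dvd hi)).toMonoidHom u) (locMap_mem hia ha hu) ?_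
  rw [val_transition, hh]
  change locMap _ (u : Localization.Away f.elt) * _ = _
  rw [← map_mul, ← mul_assoc, u.mul_inv, one_mul, locMap_algebraMap]

/-- The diagram of the affine schemes `D₊(f) = Spec A_(f)`, for `f` relevant, with transition maps
`D₊(f * g) → D₊(f)`. -/
def diagram : RelevantElement 𝒜 ⥤ Scheme.{u} where
  obj f := Spec (.of (Away 𝒜 f.elt))
  map h := Spec.map (CommRingCat.ofHom (transition (leOfHom h)))
  map_id f := by
    rw [transition_id]
    exact Spec.map_id _
  map_comp h h' := by
    rw [← Spec.map_comp, ← CommRingCat.ofHom_comp, transition_comp]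

instance {x f : RelevantElement 𝒜} (h : x ⟶ f) : IsOpenImmersion ((diagram 𝒜).map h) := by
  obtain ⟨g, ⟨e, hg⟩, hx⟩ := id (leOfHom h)
  obtain ⟨t, ht⟩ := exists_isLocalization 𝒜 f hg
  have := ht f x le_rfl (leOfHom h) hx
  let := (transition (leOfHom h)).toAlgebra
  exact IsOpenImmersion.of_isLocalization (S := Away 𝒜 x.elt) (transition le_rfl t)

instance : (diagram 𝒜 ⋙ Scheme.forget).IsLocallyDirected where
  cond := by
    intro i j k fi fj xi xj hx
    obtain ⟨b, hb, hj⟩ := id (leOfHom fj)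
    obtain ⟨e, hb'⟩ := id hb
    let l : RelevantElement 𝒜 := ⟨i.elt * b, i.relevant.mul hb⟩
    have hli : l ≤ i := ⟨b, hb, rfl⟩
    have hlj : l ≤ j := by
      obtain ⟨a, ha, hi⟩ := id (leOfHom fi)
      exact ⟨a, ha, by change i.elt * b = _; rw [hi, hj]; ring⟩
    obtain ⟨t, ht⟩ := exists_isLocalization 𝒜 k hb'
    have hl := ht i l (leOfHom fi) hli rfl
    have hjk := ht k j le_rfl (leOfHom fj) hj
    have hx' : (Spec.map (CommRingCat.ofHom (transition (leOfHom fi))) :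
        Spec (.of (Away 𝒜 i.elt)) ⟶ Spec (.of (Away 𝒜 k.elt))) xi =
        (Spec.map (CommRingCat.ofHom (transition (leOfHom fj))) :
        Spec (.of (Away 𝒜 j.elt)) ⟶ Spec (.of (Away 𝒜 k.elt))) xj := hx
    have hxi : xi ∈ Set.range ((diagram 𝒜).map (homOfLE hli)) := by
      let := (transition hli).toAlgebra
      have h1 := PrimeSpectrum.localization_away_comap_range (Away 𝒜 l.elt)
        (transition (leOfHom fi) t)
      change Set.range (PrimeSpectrum.comap (transition hli)) = _ at h1
      change xi ∈ Set.range (PrimeSpectrum.comap (transition hli))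
      rw [h1]
      let := (transition (leOfHom fj)).toAlgebra
      have h2 := PrimeSpectrum.localization_away_comap_range (Away 𝒜 j.elt)
        (transition le_rfl t)
      change Set.range (PrimeSpectrum.comap (transition (leOfHom fj))) = _ at h2
      have h3 : PrimeSpectrum.comap (transition (leOfHom fi)) xi ∈
          Set.range (PrimeSpectrum.comap (transition (leOfHom fj))) := ⟨xj, hx'.symm⟩
      rw [h2, transition_id] at h3
      exact h3
    obtain ⟨x, hx''⟩ := hxi
    refine ⟨l, homOfLE hli, homOfLE hlj, x, hx'', ?_⟩
    apply ((diagram 𝒜).map fj).isOpenEmbedding.injective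
    have hcomp : (diagram 𝒜).map (homOfLE hlj) ≫ (diagram 𝒜).map fj =
        (diagram 𝒜).map (homOfLE hli) ≫ (diagram 𝒜).map fi := by
      rw [← Functor.map_comp, ← Functor.map_comp]
      rfl
    have h1 : (diagram 𝒜).map fj ((diagram 𝒜).map (homOfLE hlj) x) =
        (diagram 𝒜).map fi ((diagram 𝒜).map (homOfLE hli) x) := by
      rw [← Scheme.Hom.comp_apply, ← Scheme.Hom.comp_apply, hcomp]
    refine h1.trans ?_
    rw [hx'']
    exact hx

/-- The multihomogeneous spectrum of a `D`-graded ring: the gluing of the affine schemes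
`D₊(f) = Spec A_(f)`, for `f` relevant, along the open subschemes `D₊(f * g)`. -/
def multiProj : Scheme.{u} := colimit (diagram 𝒜)

/-- The structure morphism to the spectrum of the degree zero part. -/
def multiProj.toSpecZero : multiProj 𝒜 ⟶ Spec (.of (𝒜 0)) :=
  colimit.desc (diagram 𝒜)
    { pt := Spec (.of (𝒜 0))
      ι :=
        { app f := Spec.map (CommRingCat.ofHom (fromZeroRingHom 𝒜 (.powers f.elt)))
          naturality x f h := by
            change Spec.map _ ≫ Spec.map _ = Spec.map _ ≫ 𝟙 _
            rw [Category.comp_id, ← Spec.map_comp, ← CommRingCat.ofHom_comp]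
            congr 2
            ext a
            rw [RingHom.comp_apply, transition, awayMap_fromZeroRingHom] } }

end Gluing

/-- `Proj_D R[T]`, for the polynomial ring over `R` in variables indexed by `J` with the
`D`-grading such that `deg T_j = w j` (the regrading of the `ℤ ^ J`-grading by `e_j ↦ w j`). -/
def polyProj (R : Type u) [CommRing R] {D : Type u} [AddCommGroup D] {J : Type} (w : J → D) :
    Scheme.{u} :=
  letI := Classical.decEq D
  letI := MvPolynomial.weightedGradedAlgebra R w
  multiProj (MvPolynomial.weightedHomogeneousSubmodule R w)

/-- The structure morphism `Proj_D R[T] → Spec R`. -/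
def polyProj.toSpec (R : Type u) [CommRing R] {D : Type u} [AddCommGroup D] {J : Type}
    (w : J → D) : polyProj R w ⟶ Spec (.of R) :=
  letI := Classical.decEq D
  letI := MvPolynomial.weightedGradedAlgebra R w
  multiProj.toSpecZero (MvPolynomial.weightedHomogeneousSubmodule R w) ≫
    Spec.map (CommRingCat.ofHom
      (algebraMap R (MvPolynomial.weightedHomogeneousSubmodule R w 0)))

section Sheaves

variable {X : Scheme.{u}}

/-- The structure sheaf as a sheaf of modules. -/
def structureModule (X : Scheme.{u}) : X.Modules := SheafOfModules.unit X.ringCatSheaf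

/-- An `𝒪_X`-module is invertible if it is locally isomorphic to `𝒪_X`. -/
def IsInvertible (L : X.Modules) : Prop :=
  ∀ x : X, ∃ U : X.Opens, x ∈ U ∧ Nonempty (L.restrict U.ι ≅ structureModule U)

/-- The tensor product of `𝒪_X`-modules: the sheafification of the presheaf
`U ↦ Γ(M, U) ⊗ Γ(N, U)`. -/
def tensor (M N : X.Modules) : X.Modules :=
  (PresheafOfModules.sheafification (𝟙 X.ringCatSheaf.obj)).obj
    (PresheafOfModules.Monoidal.tensorObj (R := X.presheaf)
      ((Scheme.Modules.toPresheafOfModules X).obj M) ((Scheme.Modules.toPresheafOfModules X).obj N))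

/-- The tensor power `L ^ ⊗ n`, for `n` a natural number. -/
def tensorPow (L : X.Modules) : ℕ → X.Modules
  | 0 => structureModule X
  | n + 1 => tensor (tensorPow L n) L

/-- `L_1 ^ ⊗ d_1 ⊗ ⋯ ⊗ L_r ^ ⊗ d_r`, for natural numbers `d_1, …, d_r`. -/
def tensorMonomial {r : ℕ} (L : Fin r → X.Modules) (d : Fin r → ℕ) : X.Modules :=
  (List.ofFn fun i ↦ tensorPow (L i) (d i)).foldr tensor (structureModule X)

/-- The invertible sheaf `A` is (isomorphic to) `L ^ d = L_1 ^ ⊗ d_1 ⊗ ⋯ ⊗ L_r ^ ⊗ d_r`, for integers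
`d_1, …, d_r`: the powers with negative exponent are moved to the other side. -/
def IsMonomial {r : ℕ} (L : Fin r → X.Modules) (d : Fin r → ℤ) (A : X.Modules) : Prop :=
  IsInvertible A ∧
    Nonempty (tensor A (tensorMonomial L fun i ↦ (-d i).toNat) ≅
      tensorMonomial L fun i ↦ (d i).toNat)

/-- The restriction of a global section to an open subset. -/
def res {A : X.Modules} (s : Γ(A, ⊤)) (U : X.Opens) : Γ(A, U) :=
  A.presheaf.map (homOfLE le_top).op s

/-- The open subset `X_s` where the global section `s` of an invertible sheaf `A` does not vanish,
i.e. the largest open subset on which `s` generates `A`. -/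
def nonvanishing {A : X.Modules} (s : Γ(A, ⊤)) : X.Opens :=
  sSup {U | ∀ V ≤ U, Function.Bijective fun a : Γ(X, V) ↦ (a • res s V : Γ(A, V))}

/-- The ring homomorphism `R → Γ(X, U)` for a scheme `X` over `R`. -/
def baseHom {R : Type u} [CommRing R] (f : X ⟶ Spec (.of R)) (U : X.Opens) : R →+* Γ(X, U) :=
  ((Scheme.ΓSpecIso (.of R)).inv ≫ f.appTop ≫ X.presheaf.map (homOfLE le_top).op).hom

/-- The images `s_u / t` in `Γ(X_t, 𝒪_X)` of the sections `s_u`, under the trivialization of `A`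
on `X_t` by the section `t`. -/
def ratios {A : X.Modules} {n : ℕ} (s : Fin n → Γ(A, ⊤)) (t : Γ(A, ⊤)) :
    Set Γ(X, nonvanishing t) :=
  {a | ∃ u, a • res t (nonvanishing t) = res (s u) (nonvanishing t)}

/-- Finitely many of the nonvanishing loci `X_{s_v}` form an affine open cover of `X`, and on each
member of that cover the images `s_u / s_v` of all the sections generate the `R`-algebra
`Γ(X_{s_v}, 𝒪_X)`. -/
def GeneratesAffineCover {R : Type u} [CommRing R] (f : X ⟶ Spec (.of R)) {A : X.Modules} {n : ℕ}
    (s : Fin n → Γ(A, ⊤)) : Prop :=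
  ∃ C : Finset (Fin n), (⨆ v ∈ C, nonvanishing (s v)) = ⊤ ∧
    ∀ v ∈ C, IsAffineOpen (nonvanishing (s v)) ∧
      letI := (baseHom f (nonvanishing (s v))).toAlgebra
      Algebra.adjoin R (ratios s (s v)) = ⊤

end Sheaves

end MultigradedProj

end

/-! Put `e_i = δ(a_i)`, and for a choice `v` of one variable in each of the `ρ` groups let `T_v = ∏
T_{i,v_i}`. Everything is read off from the charts `D₊(T_v)` and the opens `U_v = ⋂ X_{s_{i,v_i}}`.

Since the `e_i` are linearly independent, the degree of a monomial in `D` determines its degree in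
each group of variables (`blockDegree_eq_of_weight_eq`). If `f` is relevant, `A_f` has a homogeneous
unit of degree `-m e_i` with `m > 0`; comparing degrees, every monomial of a suitable power `f ^ k`
involves a variable of every group, so it is divisible by some `T_v`. As the terms of `f ^ k`
divided by `f ^ k` sum to `1`, the `D₊(T_v)` cover the spectrum (`exists_ι_relevantBlockProd_eq`).
All `T_v` have the same degree, so the functions on `D₊(T_v T_w)` are generated by those of the two
charts, which gives separatedness.

On `U_v` the rule `T_{i,u} ↦ s_{i,u} / s_{i,v_i}` evaluates polynomials as functions. Passing from
`v` to `w` multiplies the values of all polynomials of a given degree by a common factor, again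
because the degree fixes the block degrees; hence fractions of degree zero have well-defined values,
and the maps `U_v → D₊(T_v)` glue to a morphism (`mor`) under which the preimage of `D₊(T_w)` is
exactly `U_w` (`mor_preimage`).

The affine loci `X_{s_{1,v}}` already show that `X` is separated. Hence, for `v` in the given
covers, `U_v` is affine and its functions are generated by those of the `X_{s_{i,v_i}}`, that is, by
the quotients of sections (`evalHom_surjective`). The quotient `s_{i,u} / s_{i,v_i}` is the value of
`T_w / T_v`, where `w` is `v` with `i`-th entry `u`, so `U_v → D₊(T_v)` is a closed immersion and
the glued morphism is an immersion. If `X` is proper, its image in the separated target is closed.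
-/

namespace MultigradedProj

/-! ### Separatedness through generation of functions on overlaps -/

section Separated

open Scheme

/-- A morphism to an affine scheme is a closed immersion if its two components
jointly generate the ring of global sections of the source. -/
lemma isClosedImmersion_of_closure_range_union {W U V P : Scheme.{u}} [IsAffine W] [IsAffine P]
    (l : W ⟶ P) (a : P ⟶ U) (b : P ⟶ V) {p : W ⟶ U} {q : W ⟶ V} (hp : l ≫ a = p) (hq : l ≫ b = q)
    (hgen : Subring.closure (Set.range p.appTop ∪ Set.range q.appTop) = ⊤) :
    IsClosedImmersion l := by
  refine .of_surjective_of_isAffine l ?_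
  have : Subring.closure (Set.range p.appTop ∪ Set.range q.appTop) ≤ l.appTop.hom.range := by
    rw [Subring.closure_le, ← hp, ← hq]
    rintro _ (⟨x, rfl⟩ | ⟨x, rfl⟩)
    · exact ⟨a.appTop x, rfl⟩
    · exact ⟨b.appTop x, rfl⟩
  rw [hgen, top_le_iff] at this
  exact RingHom.range_eq_top.mp this

/-- A scheme with an affine open cover is separated if the pairwise intersections are affine and
their global sections are generated by those of the members of the cover. -/
lemma isSeparated_of_openCover {X : Scheme.{u}} (𝒰 : X.OpenCover) [∀ i, IsAffine (𝒰.X i)]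
    (W : 𝒰.I₀ → 𝒰.I₀ → Scheme.{u}) [∀ i j, IsAffine (W i j)] (p : ∀ i j, W i j ⟶ 𝒰.X i)
    (q : ∀ i j, W i j ⟶ 𝒰.X j) (h : ∀ i j, IsPullback (p i j) (q i j) (𝒰.f i) (𝒰.f j))
    (hgen : ∀ i j, Subring.closure (Set.range (p i j).appTop ∪ Set.range (q i j).appTop) = ⊤) :
    X.IsSeparated := by
  refine ⟨⟨IsZariskiLocalAtTarget.of_openCover (Pullback.openCoverOfLeftRight 𝒰 𝒰 _ _) ?_⟩⟩
  intro ⟨i, j⟩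
  -- Over the member `U_i × U_j` of the cover of the product, the diagonal becomes the map from `U_i
  -- ×_X U_j`, identified with `W i j`.
  have hp := pullback_map_diagonal_isPullback (𝒰.f i) (𝒰.f j) (terminal.from X)
  change IsClosedImmersion (pullback.snd (pullback.diagonal (terminal.from X))
    (pullback.map (𝒰.f i ≫ terminal.from X) (𝒰.f j ≫ terminal.from X) _ _ (𝒰.f i) (𝒰.f j) (𝟙 _)
      (Category.comp_id _) (Category.comp_id _)))
  rw [← hp.isoPullback_inv_snd,
    MorphismProperty.cancel_left_of_respectsIso (P := @IsClosedImmersion),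
    ← MorphismProperty.cancel_left_of_respectsIso (P := @IsClosedImmersion)
    (h i j).isoPullback.hom]
  refine isClosedImmersion_of_closure_range_union _ (pullback.fst _ _) (pullback.snd _ _)
    ?_ ?_ (hgen i j)
  · rw [Category.assoc, pullback.lift_fst, Category.comp_id, IsPullback.isoPullback_hom_fst]
  · rw [Category.assoc, pullback.lift_snd, Category.comp_id, IsPullback.isoPullback_hom_snd]

/-- By the universal property, the identity of `P` factors through the subring generated by the two
images, so this subring is all of `P`. -/
lemma closure_range_union_of_isPushout {A B C P : CommRingCat.{u}} {f : A ⟶ B} {g : A ⟶ C}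
    {inl : B ⟶ P} {inr : C ⟶ P} (h : IsPushout f g inl inr) :
    Subring.closure (Set.range inl ∪ Set.range inr) = ⊤ := by
  set Q := Subring.closure (Set.range inl ∪ Set.range inr)
  let a : B ⟶ .of Q := CommRingCat.ofHom
    (inl.hom.codRestrict Q fun x ↦ Subring.subset_closure (.inl ⟨x, rfl⟩))
  let b : C ⟶ .of Q := CommRingCat.ofHom
    (inr.hom.codRestrict Q fun x ↦ Subring.subset_closure (.inr ⟨x, rfl⟩))
  have hab : f ≫ a = g ≫ b := by
    ext x
    exact congr($(h.w) x)
  have hid : h.desc a b hab ≫ CommRingCat.ofHom Q.subtype = 𝟙 P := by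
    apply h.hom_ext
    · rw [IsPushout.inl_desc_assoc, Category.comp_id]; rfl
    · rw [IsPushout.inr_desc_assoc, Category.comp_id]; rfl
  refine top_le_iff.mp fun x _ ↦ ?_
  have hx : ((h.desc a b hab x : Q) : P) = x := congr($hid x)
  exact hx ▸ (h.desc a b hab x : Q).2

lemma closure_image_eq_top_iff {A B : Type*} [Ring A] [Ring B] {f : A →+* B}
    (hf : Function.Bijective f) {s : Set A} :
    Subring.closure (f '' s) = ⊤ ↔ Subring.closure s = ⊤ := by
  rw [← RingHom.map_closure, ← RingHom.range_eq_top.mpr hf.2, RingHom.range_eq_map]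
  refine ⟨fun h ↦ ?_, fun h ↦ by rw [h]⟩
  exact SetLike.coe_injective (hf.1.image_injective congr(($h : Set B)))

/-- Translates between morphisms of open subschemes, as in `isSeparated_of_openCover`, and
restriction maps of the structure sheaf, in which the generation is actually computed. -/
lemma closure_range_union_homOfLE_iff {X : Scheme.{u}} {U V W : X.Opens} (hU : W ≤ U)
    (hV : W ≤ V) :
    Subring.closure (Set.range (X.homOfLE hU).appTop ∪ Set.range (X.homOfLE hV).appTop) = ⊤ ↔
    Subring.closure (Set.range (X.presheaf.map (homOfLE hU).op) ∪
      Set.range (X.presheaf.map (homOfLE hV).op)) = ⊤ := by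
  have key (U' : X.Opens) (h : W ≤ U') : Set.range (X.presheaf.map (homOfLE h).op) =
      W.topIso.hom.hom '' Set.range (X.homOfLE h).appTop := by
    have : U'.topIso.hom ≫ X.presheaf.map (homOfLE h).op = (X.homOfLE h).appTop ≫ W.topIso.hom := by
      rw [homOfLE_appTop]
      exact (X.presheaf.map_comp (eqToHom U'.ι_image_top.symm).op _).symm.trans
        (X.presheaf.map_comp (homOfLE (X.ι_image_homOfLE_le_ι_image h ⊤)).op
          (eqToHom W.ι_image_top.symm).op)
    rw [← Set.range_comp, ← (ConcreteCategory.bijective_of_isIso U'.topIso.hom).2.range_comp]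
    exact congr(Set.range $this)
  rw [key, key, ← Set.image_union,
    closure_image_eq_top_iff (ConcreteCategory.bijective_of_isIso W.topIso.hom)]

/-- On a separated scheme, the sections over the intersection of two affine opens are generated by
the restrictions of the sections over the two opens. -/
lemma closure_range_union_of_isSeparated {X : Scheme.{u}} [X.IsSeparated] {U V : X.Opens}
    (hU : IsAffineOpen U) (hV : IsAffineOpen V) :
    Subring.closure (Set.range (X.presheaf.map (homOfLE inf_le_left : U ⊓ V ⟶ U).op) ∪
      Set.range (X.presheaf.map (homOfLE inf_le_right : U ⊓ V ⟶ V).op)) = ⊤ := by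
  have : IsAffine U := hU
  have : IsAffine V := hV
  rw [← closure_range_union_homOfLE_iff]
  -- `l` is a base change of the diagonal of `X`, hence a closed immersion of `U ⊓ V` into the
  -- affine product of `U` and `V`. It is surjective on global sections, and those of the product
  -- form a pushout.
  let l := (isPullback_opens_inf U V).isoPullback.hom ≫
    pullback.mapDesc U.ι V.ι (terminal.from X)
  have hl := (IsClosedImmersion.isAffine_surjective_of_isAffine l).2
  have := closure_range_union_of_isPushout (isPushout_appTop_of_isPullback
    (.of_hasPullback (U.ι ≫ terminal.from X) (V.ι ≫ terminal.from X)))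
  have h := congr(Subring.map l.appTop.hom $this)
  rw [RingHom.map_closure, ← RingHom.range_eq_map, RingHom.range_eq_top.mpr hl, Set.image_union,
    ← Set.range_comp, ← Set.range_comp] at h
  have h1 : X.homOfLE inf_le_left = l ≫ pullback.fst _ _ := by
    rw [Category.assoc, pullback.lift_fst, Category.comp_id, IsPullback.isoPullback_hom_fst]
  have h2 : X.homOfLE inf_le_right = l ≫ pullback.snd _ _ := by
    rw [Category.assoc, pullback.lift_snd, Category.comp_id, IsPullback.isoPullback_hom_snd]
  rw [h1, h2]
  exact h

end Separated

end MultigradedProj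

namespace MultigradedProj

/-! ### Quotients of global sections -/

section Ratio

variable {X : Scheme.{u}} {A : X.Modules}

lemma map_res (s : Γ(A, ⊤)) {U V : X.Opens} (i : V ⟶ U) :
    A.presheaf.map i.op (res s U) = res s V := by
  rw [res, res, ← ConcreteCategory.comp_apply, ← Functor.map_comp]
  rfl

lemma map_smul_res (s : Γ(A, ⊤)) {U V : X.Opens} (i : V ⟶ U) (a : Γ(X, U)) :
    A.presheaf.map i.op (a • res s U) = X.presheaf.map i.op a • res s V := by
  rw [Scheme.Modules.map_smul, map_res]

/-- A global section generates on its nonvanishing locus. -/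
lemma bijective_smul_res {s : Γ(A, ⊤)} {V : X.Opens} (hV : V ≤ nonvanishing s) :
    Function.Bijective fun a : Γ(X, V) ↦ (a • res s V : Γ(A, V)) := by
  -- These are the opens whose supremum is `nonvanishing s`. Bijectivity descends to `V` by the
  -- sheaf conditions on `𝒪_X` and `A`: local quotients by `s` are unique, so they agree on overlaps
  -- and glue.
  let 𝒮 : Set X.Opens := {U | ∀ V ≤ U, Function.Bijective fun a : Γ(X, V) ↦ (a • res s V : Γ(A, V))}
  let W : 𝒮 → X.Opens := fun U ↦ V ⊓ U
  have hW (U : 𝒮) : Function.Bijective fun a : Γ(X, W U) ↦ (a • res s (W U) : Γ(A, W U)) :=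
    U.2 _ inf_le_right
  have hcov : V ≤ iSup W := by
    rw [← inf_iSup_eq, ← sSup_eq_iSup']
    exact le_inf le_rfl hV
  let i (U : 𝒮) : W U ⟶ V := homOfLE inf_le_left
  constructor
  · intro a b hab
    refine X.sheaf.eq_of_locally_eq' W V i hcov a b fun U ↦ (hW U).1 ?_
    have := congr(A.presheaf.map (i U).op $hab)
    simp only [map_smul_res] at this
    exact this
  · intro t
    choose a ha using fun U ↦ (hW U).2 (A.presheaf.map (i U).op t)
    obtain ⟨b, hb, -⟩ := X.sheaf.existsUnique_gluing' W V i hcov a (by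
      intro U U'
      apply (U.2 (W U ⊓ W U') (inf_le_left.trans inf_le_right)).1
      have h1 := congr(A.presheaf.map (homOfLE inf_le_left : W U ⊓ W U' ⟶ W U).op $(ha U))
      have h2 := congr(A.presheaf.map (homOfLE inf_le_right : W U ⊓ W U' ⟶ W U').op $(ha U'))
      simp only [map_smul_res] at h1 h2
      refine h1.trans (Eq.trans ?_ h2.symm)
      rw [← ConcreteCategory.comp_apply, ← ConcreteCategory.comp_apply, ← Functor.map_comp,
        ← Functor.map_comp]
      rfl)
    refine ⟨b, TopCat.Sheaf.eq_of_locally_eq' (F := ⟨A.presheaf, A.isSheaf⟩) W V i hcov _ _ ?_⟩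
    intro U
    refine (map_smul_res s (i U) b).trans (Eq.trans ?_ (ha U))
    exact congrArg (fun x : Γ(X, W U) ↦ x • res s (W U)) (hb U)

/-- The quotient `s / t` of two global sections on the nonvanishing locus of `t`. -/
noncomputable def ratio (s t : Γ(A, ⊤)) : Γ(X, nonvanishing t) :=
  ((bijective_smul_res le_rfl).2 (res s (nonvanishing t))).choose

lemma ratio_smul (s t : Γ(A, ⊤)) :
    ratio s t • res t (nonvanishing t) = res s (nonvanishing t) :=
  ((bijective_smul_res le_rfl).2 (res s (nonvanishing t))).choose_spec

lemma map_ratio_smul (s t : Γ(A, ⊤)) {V : X.Opens} (i : V ⟶ nonvanishing t) :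
    X.presheaf.map i.op (ratio s t) • res t V = res s V := by
  rw [← map_smul_res, ratio_smul, map_res]

lemma ratios_eq_range {n : ℕ} (s : Fin n → Γ(A, ⊤)) (t : Γ(A, ⊤)) :
    ratios s t = Set.range fun u ↦ ratio (s u) t := by
  ext a
  refine exists_congr fun u ↦ ?_
  rw [← ratio_smul (s u) t]
  exact ((bijective_smul_res le_rfl).1.eq_iff (a := a)).trans eq_comm

lemma ratio_self (s : Γ(A, ⊤)) : ratio s s = 1 :=
  (bijective_smul_res le_rfl).1 (by simp only [ratio_smul, one_smul])

lemma map_ratio_mul_map_ratio (s t t' : Γ(A, ⊤)) {V : X.Opens} (i : V ⟶ nonvanishing t)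
    (j : V ⟶ nonvanishing t') :
    X.presheaf.map i.op (ratio t' t) * X.presheaf.map j.op (ratio s t') =
      X.presheaf.map i.op (ratio s t) := by
  refine (bijective_smul_res (leOfHom i)).1 ?_
  simp only [map_ratio_smul]
  rw [mul_comm, mul_smul, map_ratio_smul, map_ratio_smul]

/-- Inside `nonvanishing t`, multiplication of functions by `s` is multiplication by `s / t`
followed by the bijective multiplication by `t`. Conversely, where `s` generates, the inverse of `s
/ t` comes from writing `t` as a multiple of `s`. -/
lemma isUnit_map_ratio_iff (s t : Γ(A, ⊤)) {V : X.Opens} (i : V ⟶ nonvanishing t) :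
    IsUnit (X.presheaf.map i.op (ratio s t)) ↔ V ≤ nonvanishing s := by
  constructor
  · refine fun h ↦ le_sSup fun W hW ↦ ?_
    have hu := h.map (X.presheaf.map (homOfLE hW).op).hom
    set a := (X.presheaf.map (homOfLE hW).op).hom (X.presheaf.map i.op (ratio s t))
    have has : a • res t W = res s W := by
      rw [← map_res s (homOfLE hW), ← map_ratio_smul s t i, Scheme.Modules.map_smul, map_res]
    have := (bijective_smul_res (hW.trans (leOfHom i))).comp
      (IsUnit.isUnit_iff_mulRight_bijective.mp hu)
    convert! this using 2 with b
    simp only [Function.comp_apply, mul_smul, has]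
  · intro h
    obtain ⟨b, hb⟩ := (bijective_smul_res h).2 (res t V)
    refine IsUnit.of_mul_eq_one b ((bijective_smul_res (leOfHom i)).1 ?_)
    simp only [one_smul]
    rw [mul_comm, mul_smul, map_ratio_smul]
    exact hb

lemma basicOpen_ratio (s t : Γ(A, ⊤)) :
    X.basicOpen (ratio s t) = nonvanishing t ⊓ nonvanishing s := by
  apply le_antisymm
  · refine le_inf (X.basicOpen_le _) ?_
    rw [← isUnit_map_ratio_iff s t (homOfLE (X.basicOpen_le _))]
    exact RingedSpace.isUnit_res_basicOpen _ _
  · have h := (isUnit_map_ratio_iff s t (homOfLE inf_le_left)).mpr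
      (inf_le_right : nonvanishing t ⊓ nonvanishing s ≤ _)
    rw [← X.basicOpen_of_isUnit h, Scheme.basicOpen_res]
    exact inf_le_right

end Ratio

end MultigradedProj

namespace MultigradedProj

open HomogeneousLocalization SetLike

/-! ### Charts of the multihomogeneous spectrum and their overlaps -/

section Separated

lemma closure_range_union_SpecMap {A B C : CommRingCat.{u}} (f : A ⟶ C) (g : B ⟶ C)
    (h : Subring.closure (Set.range f ∪ Set.range g) = ⊤) :
    Subring.closure (Set.range (Spec.map f).appTop ∪ Set.range (Spec.map g).appTop) = ⊤ := by
  have key (A : CommRingCat.{u}) (f : A ⟶ C) : Set.range f =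
      (Scheme.ΓSpecIso C).hom.hom '' Set.range (Spec.map f).appTop := by
    rw [← Set.range_comp,
      ← (ConcreteCategory.bijective_of_isIso (Scheme.ΓSpecIso A).hom).2.range_comp]
    have := (Scheme.ΓSpecIso_naturality f).symm
    exact congr(Set.range $this)
  rwa [key, key, ← Set.image_union,
    closure_image_eq_top_iff (ConcreteCategory.bijective_of_isIso (Scheme.ΓSpecIso C).hom)] at h

end Separated

section Gluing

variable {D A : Type u} {σ : Type w} [AddCommGroup D] [CommRing A]
  [SetLike σ A] [AddSubgroupClass σ A] [DecidableEq D] {𝒜 : D → σ} [GradedRing 𝒜]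

/-- The product of two relevant elements. -/
def RelevantElement.mul (f g : RelevantElement 𝒜) : RelevantElement 𝒜 :=
  ⟨f.elt * g.elt, f.relevant.mul g.relevant.homogeneous⟩

lemma RelevantElement.mul_le_left (f g : RelevantElement 𝒜) : f.mul g ≤ f :=
  ⟨g.elt, g.relevant.homogeneous, rfl⟩

lemma RelevantElement.mul_le_right (f g : RelevantElement 𝒜) : f.mul g ≤ g :=
  ⟨f.elt, f.relevant.homogeneous, mul_comm _ _⟩

/-- The inclusion of `D₊(f)` into the multihomogeneous spectrum. -/
noncomputable def multiProj.ι (f : RelevantElement 𝒜) :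
    Spec (.of (Away 𝒜 f.elt)) ⟶ multiProj 𝒜 :=
  colimit.ι (diagram 𝒜) f

instance (f : RelevantElement 𝒜) : IsOpenImmersion (multiProj.ι f) :=
  inferInstanceAs (IsOpenImmersion (colimit.ι (diagram 𝒜) f))

/-- The open immersion `D₊(x) → D₊(f)` for `x ≤ f`. -/
noncomputable def multiProj.map {x f : RelevantElement 𝒜} (h : x ≤ f) :
    Spec (.of (Away 𝒜 x.elt)) ⟶ Spec (.of (Away 𝒜 f.elt)) :=
  Spec.map (CommRingCat.ofHom (transition h))

instance {x f : RelevantElement 𝒜} (h : x ≤ f) : IsOpenImmersion (multiProj.map h) :=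
  inferInstanceAs (IsOpenImmersion ((diagram 𝒜).map (homOfLE h)))

lemma multiProj.map_ι {x f : RelevantElement 𝒜} (h : x ≤ f) :
    multiProj.map h ≫ multiProj.ι f = multiProj.ι x :=
  colimit.w (diagram 𝒜) (homOfLE h)

lemma multiProj.map_map {x y z : RelevantElement 𝒜} (h : x ≤ y) (h' : y ≤ z) :
    multiProj.map h ≫ multiProj.map h' = multiProj.map (h.trans h') :=
  ((diagram 𝒜).map_comp (homOfLE h) (homOfLE h')).symm

lemma multiProj.ι_toSpecZero (f : RelevantElement 𝒜) :
    multiProj.ι f ≫ multiProj.toSpecZero 𝒜 =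
      Spec.map (CommRingCat.ofHom (fromZeroRingHom 𝒜 (.powers f.elt))) :=
  colimit.ι_desc _ _

lemma multiProj.exists_ι_eq (x : multiProj 𝒜) : ∃ f y, multiProj.ι (𝒜 := 𝒜) f y = x :=
  Scheme.IsLocallyDirected.ι_jointly_surjective (diagram 𝒜) x

/-- Inside `D₊(f)`, the open subset `D₊(f * g)` is the basic open of `g / f ^ n` if the degree of
`g` is `n` times the degree of `f`. -/
lemma multiProj.opensRange_map {x f : RelevantElement 𝒜} (h : x ≤ f) {d : D} (hf : f.elt ∈ 𝒜 d)
    (n : ℕ) {g : A} (hg : g ∈ 𝒜 (n • d)) (hx : x.elt = f.elt * g) :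
    (multiProj.map h).opensRange = PrimeSpectrum.basicOpen (Away.mk 𝒜 hf n g hg) := by
  let := (transition h).toAlgebra
  have hu : IsUnit (algebraMap A (Localization.Away f.elt) (f.elt ^ n)) := by
    rw [map_pow]
    exact (IsLocalization.Away.algebraMap_isUnit f.elt).pow n
  have hloc : IsLocalization.Away (Away.mk 𝒜 hf n g hg) (Away 𝒜 x.elt) := by
    -- The homogeneous unit of `A_f` of the same degree as `g` is `f ^ n` itself, so the exponent `m
    -- = 1` suffices.
    have := isLocalization_awayMap hf hg hx (Away.mk 𝒜 hf n g hg) (m := 1) one_pos hu.unit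
      (by rw [one_smul]; exact algebraMap_mem_awayPiece (pow_mem_graded n hf)) (by
        rw [IsUnit.unit_spec, Away.val_mk, Localization.mk_eq_mk'_apply, mul_comm, pow_one]
        exact IsLocalization.mk'_spec (M := .powers f.elt) _ g ⟨f.elt ^ n, n, rfl⟩)
    rwa [← transition_eq h hg hx] at this
  exact TopologicalSpace.Opens.ext
    (PrimeSpectrum.localization_away_comap_range (Away 𝒜 x.elt) (Away.mk 𝒜 hf n g hg))

/-- The function cutting out `D₊(f * f)` in `D₊(f)` is `f / f = 1`. This serves to replace a common
lower bound `k` of `f` and `g`, which need not lie below `f.mul g` in the divisibility order, by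
`k.mul k`, which does. -/
lemma multiProj.surjective_map_mul_self (f : RelevantElement 𝒜) :
    Function.Surjective (multiProj.map (f.mul_le_left f)) := by
  obtain ⟨d, hd⟩ := f.relevant.homogeneous
  have hd' : f.elt ∈ 𝒜 (1 • d) := by rwa [one_smul]
  have h := multiProj.opensRange_map (f.mul_le_left f) hd 1 hd' rfl
  have h1 : Away.mk 𝒜 hd 1 f.elt hd' = 1 := by
    ext
    rw [Away.val_mk, val_one, Localization.mk_eq_mk'_apply, IsLocalization.mk'_eq_iff_eq_mul]
    simp
  rw [h1, PrimeSpectrum.basicOpen_one] at h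
  exact Set.range_eq_univ.mp congr(($h).1)

/-- The intersection of `D₊(f)` and `D₊(g)` is `D₊(f * g)`. -/
lemma multiProj.exists_map_eq {f g : RelevantElement 𝒜} {x : Spec (.of (Away 𝒜 f.elt))}
    {y : Spec (.of (Away 𝒜 g.elt))} (h : multiProj.ι f x = multiProj.ι g y) :
    ∃ z, multiProj.map (f.mul_le_left g) z = x ∧ multiProj.map (f.mul_le_right g) z = y := by
  obtain ⟨k, hf, hg, z, hx, hy⟩ := Scheme.IsLocallyDirected.ι_eq_ι_iff (diagram 𝒜) |>.mp h
  obtain ⟨z, rfl⟩ := multiProj.surjective_map_mul_self k z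
  have hk : k.mul k ≤ f.mul g := by
    obtain ⟨a, ha, hfa⟩ := leOfHom hf
    obtain ⟨b, hb, hgb⟩ := leOfHom hg
    refine ⟨a * b, ha.mul hb, ?_⟩
    change k.elt * k.elt = f.elt * g.elt * (a * b)
    nth_rw 1 [hfa]
    rw [hgb]
    ring
  refine ⟨multiProj.map hk z, ?_, ?_⟩
  · rw [← hx]
    change (multiProj.map _ ≫ multiProj.map _) z = (multiProj.map _ ≫ multiProj.map (leOfHom hf)) z
    rw [multiProj.map_map, multiProj.map_map]
  · rw [← hy]
    change (multiProj.map _ ≫ multiProj.map _) z = (multiProj.map _ ≫ multiProj.map (leOfHom hg)) z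
    rw [multiProj.map_map, multiProj.map_map]

lemma multiProj.preimage_opensRange_ι (f g : RelevantElement 𝒜) :
    multiProj.ι f ⁻¹ᵁ (multiProj.ι g).opensRange =
      (multiProj.map (f.mul_le_left g)).opensRange := by
  ext x
  constructor
  · rintro ⟨y, hy⟩
    obtain ⟨z, hz, -⟩ := multiProj.exists_map_eq hy.symm
    exact ⟨z, hz⟩
  · rintro ⟨z, rfl⟩
    refine ⟨multiProj.map (f.mul_le_right g) z, ?_⟩
    rw [← Scheme.Hom.comp_apply, ← Scheme.Hom.comp_apply, multiProj.map_ι, multiProj.map_ι]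

lemma multiProj.isPullback (f g : RelevantElement 𝒜) :
    IsPullback (multiProj.map (f.mul_le_left g)) (multiProj.map (f.mul_le_right g))
      (multiProj.ι f) (multiProj.ι g) :=
  (IsOpenImmersion.isPullback _ _ _ _ (by rw [multiProj.map_ι, multiProj.map_ι])
    (multiProj.preimage_opensRange_ι f g)).flip

/-- The identity is `a / (f g) ^ n = (a / f ^ (2 n)) * (f ^ n / g ^ n)`. Both factors have degree
zero precisely because `f` and `g` have equal degree. -/
lemma closure_range_transition_union {x f g : RelevantElement 𝒜} (hf : x ≤ f) (hg : x ≤ g)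
    (hx : x.elt = f.elt * g.elt) {d : D} (hfd : f.elt ∈ 𝒜 d) (hgd : g.elt ∈ 𝒜 d) :
    Subring.closure (Set.range (transition hf) ∪ Set.range (transition hg)) = ⊤ := by
  have hxd : x.elt ∈ 𝒜 (d + d) := hx ▸ mul_mem_graded hfd hgd
  refine top_le_iff.mp fun z _ ↦ ?_
  obtain ⟨n, a, ha, rfl⟩ := Away.mk_surjective 𝒜 hxd z
  have ha' : a ∈ 𝒜 ((2 * n) • d) := by
    rwa [show (2 * n) • d = n • (d + d) by rw [← two_nsmul, smul_smul, mul_comm]]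
  have : Away.mk 𝒜 hxd n a ha = transition hf (Away.mk 𝒜 hfd (2 * n) a ha') *
      transition hg (Away.mk 𝒜 hgd n (f.elt ^ n) (pow_mem_graded n hfd)) := by
    rw [transition_eq hf hgd hx, transition_eq hg hfd (hx.trans (mul_comm _ _))]
    ext
    rw [val_mul, awayMap_mk, awayMap_mk, Away.val_mk, Away.val_mk, Away.val_mk, Localization.mk_mul,
      Localization.mk_eq_mk_iff, Localization.r_iff_exists]
    refine ⟨1, ?_⟩
    simp only [OneMemClass.coe_one, one_mul, Submonoid.mk_mul_mk, hx]
    ring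
  rw [this]
  exact mul_mem (Subring.subset_closure (.inl ⟨_, rfl⟩)) (Subring.subset_closure (.inr ⟨_, rfl⟩))

/-- A multihomogeneous spectrum covered by the `D₊(f i)`, with all `f i` of the same degree,
is separated. -/
lemma multiProj.isSeparated {ι : Type*} (f : ι → RelevantElement 𝒜) (d : D)
    (hd : ∀ i, (f i).elt ∈ 𝒜 d) (hf : ∀ x : multiProj 𝒜, ∃ i y, multiProj.ι (f i) y = x) :
    (multiProj 𝒜).IsSeparated := by
  let 𝒰 : (multiProj 𝒜).OpenCover := .mkOfCovers ι _ (fun i ↦ multiProj.ι (f i)) hf inferInstance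
  have (i : 𝒰.I₀) : IsAffine (𝒰.X i) :=
    inferInstanceAs (IsAffine (Spec (.of (Away 𝒜 (f i).elt))))
  exact isSeparated_of_openCover 𝒰 (fun i j ↦ Spec (.of (Away 𝒜 ((f i).mul (f j)).elt)))
    (fun i j ↦ multiProj.map ((f i).mul_le_left (f j)))
    (fun i j ↦ multiProj.map ((f i).mul_le_right (f j)))
    (fun i j ↦ multiProj.isPullback (f i) (f j))
    (fun i j ↦ closure_range_union_SpecMap _ _
      (closure_range_transition_union ((f i).mul_le_left (f j)) ((f i).mul_le_right (f j)) rfl (hd i) (hd j)))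

end Gluing

end MultigradedProj

namespace MultigradedProj

open HomogeneousLocalization SetLike

/-! ### Weights and block degrees of monomials -/

section Weights

variable {D : Type*} [AddCommGroup D]

/-- A linearly independent family of maximal length in a finitely generated abelian group
generates a subgroup of finite index. -/
lemma finiteIndex_closure_of_linearIndependent [Module.Finite ℤ D] {I : Type*} [Fintype I]
    {e : I → D} (he : LinearIndependent ℤ e) (hI : Fintype.card I = Module.finrank ℤ D) :
    (AddSubgroup.closure (Set.range e)).FiniteIndex := by
  have h1 := finrank_span_eq_card he
  have h2 := Submodule.finrank_quotient_add_finrank (Submodule.span ℤ (Set.range e))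
  have h3 : Module.finrank ℤ (D ⧸ Submodule.span ℤ (Set.range e)) = 0 := by omega
  have := Module.finite_of_fg_torsion (D ⧸ Submodule.span ℤ (Set.range e))
    (Module.finrank_eq_zero_iff_isTorsion.mp h3)
  rw [← Submodule.span_int_eq_addSubgroupClosure]
  have : Finite (D ⧸ (Submodule.span ℤ (Set.range e)).toAddSubgroup) := this
  exact AddSubgroup.finiteIndex_of_finite_quotient

lemma linearIndependent_of_basis_tensor {I : Type*} {e : I → D} (b : Module.Basis I ℚ (ℚ ⊗[ℤ] D))
    (hb : ∀ i, b i = 1 ⊗ₜ[ℤ] e i) : LinearIndependent ℤ e := by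
  refine LinearIndependent.of_comp (TensorProduct.mk ℤ ℚ D 1) ?_
  convert! b.linearIndependent.restrict_scalars' ℤ using 1
  ext i
  simp [hb]

variable {I : Type} {N : I → Type} [∀ i, Fintype (N i)]

/-- The degree of a monomial in the `i`-th group of variables. -/
def blockDegree (α : (Σ i, N i) →₀ ℕ) (i : I) : ℕ := ∑ u, α ⟨i, u⟩

lemma blockDegree_add (α β : (Σ i, N i) →₀ ℕ) (i : I) :
    blockDegree (α + β) i = blockDegree α i + blockDegree β i := by
  simp [blockDegree, Finset.sum_add_distrib]

variable [Fintype I]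

lemma weight_eq_sum_blockDegree (e : I → D) (α : (Σ i, N i) →₀ ℕ) :
    Finsupp.weight (fun j : Σ i, N i ↦ e j.1) α = ∑ i, blockDegree α i • e i := by
  rw [Finsupp.weight_apply, Finsupp.sum_fintype _ _ (by simp), Fintype.sum_sigma]
  simp [blockDegree, Finset.sum_smul]

/-- A weight is the combination of the `e i` with the block degrees as coefficients, and linear
independence recovers these. The integral shift `c` allows weights differing by a combination of the
`e i` to be compared, as needed for units of negative degree. -/
lemma blockDegree_eq_of_weight_eq {e : I → D} (he : LinearIndependent ℤ e)
    {α β : (Σ i, N i) →₀ ℕ} {c : I → ℤ}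
    (h : Finsupp.weight (fun j : Σ i, N i ↦ e j.1) α + ∑ i, c i • e i =
      Finsupp.weight (fun j : Σ i, N i ↦ e j.1) β) (i : I) :
    (blockDegree β i : ℤ) = blockDegree α i + c i := by
  rw [weight_eq_sum_blockDegree, weight_eq_sum_blockDegree] at h
  have := Fintype.linearIndependent_iff.mp he
    (fun i ↦ (blockDegree α i + c i - blockDegree β i : ℤ)) (by
      simp only [sub_smul, add_smul, Finset.sum_sub_distrib, Finset.sum_add_distrib, natCast_zsmul,
        h, sub_self]) i
  omega

end Weights

/-! ### Relevant elements of the polynomial ring and separatedness -/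

section Poly

open MvPolynomial

attribute [local instance] MvPolynomial.weightedGradedAlgebra

variable {R D : Type u} [CommRing R] [AddCommGroup D] [DecidableEq D]
  {I : Type} [Fintype I] {N : I → Type} {e : I → D}

variable (R) in
/-- The product of one variable of each group. -/
noncomputable def blockProd (v : ∀ i, N i) : MvPolynomial (Σ i, N i) R := ∏ i, X ⟨i, v i⟩

omit [DecidableEq D] [Fintype I] in
lemma X_mem (e : I → D) (j : Σ i, N i) :
    (X j : MvPolynomial (Σ i, N i) R) ∈ weightedHomogeneousSubmodule R (fun j ↦ e j.1) (e j.1) :=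
  isWeightedHomogeneous_X R _ j

omit [DecidableEq D] in
lemma blockProd_mem (e : I → D) (v : ∀ i, N i) :
    blockProd R v ∈ weightedHomogeneousSubmodule R (fun j : Σ i, N i ↦ e j.1) (∑ i, e i) :=
  IsWeightedHomogeneous.prod _ _ _ fun i _ ↦ X_mem e ⟨i, v i⟩

lemma blockProd_eq_monomial (v : ∀ i, N i) :
    blockProd R v = monomial (∑ i, Finsupp.single ⟨i, v i⟩ 1) 1 := by
  rw [monomial_sum_one]
  rfl

variable (R) in
lemma X_dvd_blockProd (v : ∀ i, N i) (i : I) :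
    (X ⟨i, v i⟩ : MvPolynomial (Σ i, N i) R) ∣ blockProd R v :=
  Finset.dvd_prod_of_mem (fun i ↦ (X ⟨i, v i⟩ : MvPolynomial (Σ i, N i) R)) (Finset.mem_univ i)

/-- Inverting the product inverts one variable of each group, so every `e i` is the degree of a
homogeneous unit. -/
lemma isRelevant_blockProd (he : (AddSubgroup.closure (Set.range e)).FiniteIndex) (v : ∀ i, N i) :
    IsRelevant (weightedHomogeneousSubmodule R fun j : Σ i, N i ↦ e j.1) (blockProd R v) where
  homogeneous := ⟨_, blockProd_mem e v⟩
  periodic := by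
    refine AddSubgroup.finiteIndex_of_le (H := AddSubgroup.closure (Set.range e))
      (AddSubgroup.closure_mono ?_)
    rintro _ ⟨i, rfl⟩
    have h := isUnit_of_dvd_unit
      (map_dvd (algebraMap _ (Localization.Away (blockProd R v))) (X_dvd_blockProd R v i))
      (IsLocalization.Away.algebraMap_isUnit (blockProd R v))
    exact ⟨h.unit, algebraMap_mem_awayPiece (X_mem e ⟨i, v i⟩)⟩

/-- The relevant element `∏ T_{i, v i}`. -/
noncomputable def relevantBlockProd (he : (AddSubgroup.closure (Set.range e)).FiniteIndex)
    (v : ∀ i, N i) : RelevantElement (weightedHomogeneousSubmodule R fun j : Σ i, N i ↦ e j.1) :=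
  ⟨blockProd R v, isRelevant_blockProd he v⟩

variable [∀ i, Fintype (N i)]

/-- A unit of degree `-m e_i` is a fraction `a / f ^ k` with `deg a + m e_i = deg f ^ k`. Comparing
one monomial of `a` with any monomial of `f ^ k` shows that the latter has block degree at least `m
> 0` at `i`. -/
lemma IsRelevant.exists_pow_blockDegree_pos (he : LinearIndependent ℤ e)
    {f : MvPolynomial (Σ i, N i) R}
    (hf : IsRelevant (weightedHomogeneousSubmodule R fun j : Σ i, N i ↦ e j.1) f) (i : I) :
    ∃ k, ∀ β ∈ (f ^ k).support, 0 < blockDegree β i := by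
  obtain ⟨m, hm, u, k, d, a, hfk, ha, hu⟩ := hf.exists_unit (-e i)
  by_cases h0 : a = 0
  -- A zero numerator makes `f ^ k` vanish in `A_f`; then some power of `f` is zero and has empty
  -- support.
  · rw [h0, map_zero, u.isUnit.mul_right_eq_zero] at hu
    obtain ⟨⟨_, j, rfl⟩, hj⟩ := (IsLocalization.map_eq_zero_iff (Submonoid.powers f) _ _).mp hu
    refine ⟨j + k, fun β hβ ↦ ?_⟩
    rw [pow_add, hj] at hβ
    simp at hβ
  · obtain ⟨α, hα⟩ := support_nonempty.mpr h0
    refine ⟨k, fun β hβ ↦ ?_⟩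
    have h1 := ha (mem_support_iff.mp hα)
    have h2 := hfk (mem_support_iff.mp hβ)
    classical
    have := blockDegree_eq_of_weight_eq he (α := α) (β := β) (c := Pi.single i m) (by
      rw [h1, h2, Finset.sum_eq_single i (by simp +contextual) (by simp)]
      simp) i
    simp at this
    omega

lemma IsRelevant.exists_pow_forall_blockDegree_pos (he : LinearIndependent ℤ e)
    {f : MvPolynomial (Σ i, N i) R}
    (hf : IsRelevant (weightedHomogeneousSubmodule R fun j : Σ i, N i ↦ e j.1) f) :
    ∃ k, ∀ β ∈ (f ^ k).support, ∀ i, 0 < blockDegree β i := by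
  classical
  choose k hk using hf.exists_pow_blockDegree_pos he
  -- This exponent serves all `i` at once: a monomial of the power is a product of one from `f ^ k
  -- i` and another one, and block degrees add.
  refine ⟨∑ i, k i, fun β hβ i ↦ ?_⟩
  rw [← Finset.add_sum_erase _ _ (Finset.mem_univ i), pow_add] at hβ
  obtain ⟨β₁, h₁, β₂, -, rfl⟩ := Finset.mem_add.mp (support_mul _ _ hβ)
  rw [blockDegree_add]
  exact Nat.add_pos_left (hk i β₁ h₁) _

lemma exists_monomial_eq_blockProd_mul {β : (Σ i, N i) →₀ ℕ} (hβ : ∀ i, 0 < blockDegree β i)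
    (c : R) : ∃ (v : ∀ i, N i) (γ : (Σ i, N i) →₀ ℕ),
      monomial β c = blockProd R v * monomial γ c := by
  classical
  have (i : I) : ∃ u, 0 < β ⟨i, u⟩ := by
    by_contra! h
    refine (hβ i).ne' (Finset.sum_eq_zero fun u _ ↦ ?_)
    exact Nat.le_zero.mp (h u)
  choose v hv using this
  have hle : ∑ i, Finsupp.single (⟨i, v i⟩ : Σ i, N i) 1 ≤ β := by
    intro ⟨i, u⟩
    rw [Finsupp.finsetSum_apply, Finset.sum_eq_single i]
    · rw [Finsupp.single_apply]
      split_ifs with h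
      · cases h; exact hv i
      · exact Nat.zero_le _
    · intro j _ hj
      exact Finsupp.single_eq_of_ne (by rintro h; cases h; exact hj rfl)
    · simp
  refine ⟨v, β - ∑ i, Finsupp.single ⟨i, v i⟩ 1, ?_⟩
  rw [blockProd_eq_monomial, monomial_mul, one_mul, add_tsub_cancel_of_le hle]

/-- The multihomogeneous spectrum of a polynomial ring is covered by the `D₊(∏ T_{i, v i})`. -/
lemma exists_ι_relevantBlockProd_eq (he : LinearIndependent ℤ e)
    (he' : (AddSubgroup.closure (Set.range e)).FiniteIndex)
    (x : multiProj (weightedHomogeneousSubmodule R fun j : Σ i, N i ↦ e j.1)) :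
    ∃ v y, multiProj.ι (relevantBlockProd (R := R) he' v) y = x := by
  obtain ⟨f, y, rfl⟩ := multiProj.exists_ι_eq x
  obtain ⟨d, hd⟩ := f.relevant.homogeneous
  obtain ⟨k, hk⟩ := f.relevant.exists_pow_forall_blockDegree_pos he
  have hmem (β) (hβ : β ∈ (f.elt ^ k).support) : monomial β (coeff β (f.elt ^ k)) ∈
      weightedHomogeneousSubmodule R (fun j : Σ i, N i ↦ e j.1) (k • d) :=
    isWeightedHomogeneous_monomial _ _ _ (pow_mem_graded k hd (mem_support_iff.mp hβ))
  -- The terms of `f ^ k` divided by `f ^ k` sum to `1`, so one of them does not vanish at `y`. The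
  -- corresponding monomial is divisible by some `∏ T_{i, v i}`, whose chart therefore contains the
  -- point.
  let q (β : (f.elt ^ k).support) := Away.mk _ hd k _ (hmem β.1 β.2)
  have hq : ∑ β, q β = 1 := by
    have hv : (∑ β, q β).val = 1 := by
      have hu : IsUnit (algebraMap _ (Localization.Away f.elt) (f.elt ^ k)) := by
        rw [map_pow]
        exact (IsLocalization.Away.algebraMap_isUnit f.elt).pow k
      apply hu.mul_right_cancel
      rw [← HomogeneousLocalization.algebraMap_apply, map_sum, Finset.sum_mul, one_mul]
      conv_rhs => rw [(f.elt ^ k).as_sum, map_sum, ← Finset.sum_coe_sort]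
      refine Finset.sum_congr rfl fun β _ ↦ ?_
      rw [HomogeneousLocalization.algebraMap_apply, Away.val_mk, Localization.mk_eq_mk'_apply]
      exact IsLocalization.mk'_spec (M := .powers f.elt) _ _ ⟨f.elt ^ k, k, rfl⟩
    ext
    rw [hv, val_one]
  obtain ⟨β, hβ⟩ : ∃ β, q β ∉ y.asIdeal := by
    by_contra! h
    exact y.2.ne_top ((Ideal.eq_top_iff_one _).mpr (hq ▸ sum_mem fun β _ ↦ h β))
  let g : RelevantElement (weightedHomogeneousSubmodule R fun j : Σ i, N i ↦ e j.1) :=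
    ⟨f.elt * monomial β.1 (coeff β.1 (f.elt ^ k)), f.relevant.mul ⟨_, hmem β.1 β.2⟩⟩
  have hgf : g ≤ f := ⟨_, ⟨_, hmem β.1 β.2⟩, rfl⟩
  obtain ⟨v, γ, hv⟩ := exists_monomial_eq_blockProd_mul (hk β.1 β.2) (coeff β.1 (f.elt ^ k))
  have hgv : g ≤ relevantBlockProd he' v := by
    refine ⟨f.elt * monomial γ (coeff β.1 (f.elt ^ k)),
      f.relevant.homogeneous.mul ⟨_, isWeightedHomogeneous_monomial _ _ _ rfl⟩, ?_⟩
    change f.elt * monomial β.1 (coeff β.1 (f.elt ^ k)) = blockProd R v * _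
    rw [hv]
    ring
  have hy : y ∈ (multiProj.map hgf).opensRange := by
    rw [multiProj.opensRange_map hgf hd k (hmem β.1 β.2) rfl]
    exact hβ
  obtain ⟨z, rfl⟩ := hy
  refine ⟨v, multiProj.map hgv z, ?_⟩
  rw [← Scheme.Hom.comp_apply, ← Scheme.Hom.comp_apply, multiProj.map_ι, multiProj.map_ι]

/-- The multihomogeneous spectrum of a polynomial ring is separated. -/
lemma isSeparated_multiProj_poly (he : LinearIndependent ℤ e)
    (he' : (AddSubgroup.closure (Set.range e)).FiniteIndex) :
    (multiProj (weightedHomogeneousSubmodule R fun j : Σ i, N i ↦ e j.1)).IsSeparated :=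
  multiProj.isSeparated (fun v ↦ relevantBlockProd he' v) (∑ i, e i)
    (fun v ↦ blockProd_mem e v) (exists_ι_relevantBlockProd_eq he he')

end Poly

end MultigradedProj

namespace MultigradedProj

/-! ### Evaluating polynomials at quotients of sections -/

section RatioSystem

/-- Open subsets `U v` of a scheme together with functions `r v u` on `U v` that behave like the
quotients `s u / s v` of global sections of an invertible sheaf. -/
structure RatioSystem (X : Scheme.{u}) (N : Type) where
  U : N → X.Opens
  r : ∀ v, N → Γ(X, U v)
  r_self : ∀ v, r v v = 1
  map_mul_map : ∀ {V : X.Opens} {v v' : N} (i : V ⟶ U v) (j : V ⟶ U v') (u : N),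
    X.presheaf.map i.op (r v v') * X.presheaf.map j.op (r v' u) = X.presheaf.map i.op (r v u)
  basicOpen_r : ∀ v u, X.basicOpen (r v u) = U v ⊓ U u

/-- The quotients of global sections. -/
noncomputable def RatioSystem.ofSections {X : Scheme.{u}} {A : X.Modules} {N : Type}
    (s : N → Γ(A, ⊤)) : RatioSystem X N where
  U v := nonvanishing (s v)
  r v u := ratio (s u) (s v)
  r_self _ := ratio_self _
  map_mul_map i j _ := map_ratio_mul_map_ratio _ _ _ i j
  basicOpen_r _ _ := basicOpen_ratio _ _

variable {R : Type u} [CommRing R] {X : Scheme.{u}} (f : X ⟶ Spec (.of R))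

lemma map_baseHom {U V : X.Opens} (i : V ⟶ U) (a : R) :
    X.presheaf.map i.op (baseHom f U a) = baseHom f V a := by
  change (X.presheaf.map _ ≫ X.presheaf.map i.op) _ = _
  rw [← Functor.map_comp]
  rfl

namespace RatioSystem

variable {N : Type} (S : RatioSystem X N)

lemma isUnit_map_r_iff {v : N} {V : X.Opens} (i : V ⟶ S.U v) (u : N) :
    IsUnit (X.presheaf.map i.op (S.r v u)) ↔ V ≤ S.U u := by
  constructor
  · intro h
    have h1 := X.basicOpen_res (S.r v u) i.op
    rw [X.basicOpen_of_isUnit h, S.basicOpen_r] at h1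
    exact h1.le.trans (inf_le_right.trans inf_le_right)
  · intro h
    refine IsUnit.of_mul_eq_one (X.presheaf.map (homOfLE h).op (S.r u v)) ?_
    rw [S.map_mul_map i (homOfLE h), S.r_self, map_one]

/-- The overlap is the basic open of `r v v'` in the affine `U v`, so its functions are fractions
with powers of `r v v'` as denominators; the inverse of `r v v'` is the restriction of `r v' v` from
the other side. -/
lemma closure_range_union_r {v v' : N} (hv : IsAffineOpen (S.U v)) :
    Subring.closure (Set.range (X.presheaf.map (homOfLE inf_le_left : S.U v ⊓ S.U v' ⟶ _).op) ∪
      Set.range (X.presheaf.map (homOfLE inf_le_right : S.U v ⊓ S.U v' ⟶ _).op)) = ⊤ := by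
  let := (X.presheaf.map (homOfLE inf_le_left : S.U v ⊓ S.U v' ⟶ _).op).hom.toAlgebra
  have := hv.isLocalization_of_eq_basicOpen (S.r v v') (homOfLE inf_le_left)
    (S.basicOpen_r v v').symm
  refine top_le_iff.mp fun z _ ↦ ?_
  obtain ⟨⟨a, ⟨_, n, rfl⟩⟩, h⟩ := IsLocalization.surj (Submonoid.powers (S.r v v')) z
  have h1 : X.presheaf.map (homOfLE inf_le_left : S.U v ⊓ S.U v' ⟶ _).op (S.r v v') *
      X.presheaf.map (homOfLE inf_le_right : S.U v ⊓ S.U v' ⟶ _).op (S.r v' v) = 1 := by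
    rw [S.map_mul_map, S.r_self, map_one]
  have h2 : z = X.presheaf.map (homOfLE inf_le_left : S.U v ⊓ S.U v' ⟶ _).op a *
      X.presheaf.map (homOfLE inf_le_right : S.U v ⊓ S.U v' ⟶ _).op (S.r v' v) ^ n := by
    have h3 : z * X.presheaf.map (homOfLE inf_le_left : S.U v ⊓ S.U v' ⟶ _).op (S.r v v' ^ n) =
      X.presheaf.map (homOfLE inf_le_left : S.U v ⊓ S.U v' ⟶ _).op a := h
    rw [← h3, map_pow, mul_assoc, ← mul_pow, h1, one_pow, mul_one]
  rw [h2]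
  exact mul_mem (Subring.subset_closure (.inl ⟨_, rfl⟩))
    (pow_mem (Subring.subset_closure (.inr ⟨_, rfl⟩)) n)

/-- A scheme is separated if it is covered by affine nonvanishing loci of sections of one
invertible sheaf. -/
lemma isSeparated (C : Finset N) (hC : ⨆ v ∈ C, S.U v = ⊤) (hS : ∀ v ∈ C, IsAffineOpen (S.U v)) :
    X.IsSeparated := by
  let 𝒰 : X.OpenCover := X.openCoverOfIsOpenCover (fun v : C ↦ S.U v)
    (by rw [TopologicalSpace.IsOpenCover, ← hC, iSup_subtype'])
  have (v : 𝒰.I₀) : IsAffine (𝒰.X v) := hS v.1 v.2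
  have (v v' : 𝒰.I₀) : IsAffine (S.U v.1 ⊓ S.U v'.1 : X.Opens).toScheme := by
    rw [← S.basicOpen_r]
    exact (hS v.1 v.2).basicOpen _
  exact isSeparated_of_openCover 𝒰 (fun v v' ↦ (S.U v.1 ⊓ S.U v'.1 : X.Opens).toScheme)
    (fun v v' ↦ X.homOfLE inf_le_left) (fun v v' ↦ X.homOfLE inf_le_right)
    (fun v v' ↦ isPullback_opens_inf (S.U v.1) (S.U v'.1))
    (fun v v' ↦ (closure_range_union_homOfLE_iff _ _).mpr (S.closure_range_union_r (hS v.1 v.2)))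

end RatioSystem

open MvPolynomial

variable {I : Type} {N : I → Type} (S : ∀ i, RatioSystem X (N i))

/-- The intersection of the opens `U i (v i)`. -/
def interOpen (v : ∀ i, N i) : X.Opens := ⨅ i, (S i).U (v i)

variable {S}

lemma le_of_le_interOpen {v : ∀ i, N i} {V : X.Opens} (hV : V ≤ interOpen S v) (i : I) :
    V ≤ (S i).U (v i) :=
  hV.trans (iInf_le _ i)

/-- The homomorphism from the polynomial ring to the functions on an open subset of `U v`
that maps the variable `T i u` to the quotient `s i u / s i (v i)`. -/
noncomputable def evalHom {v : ∀ i, N i} {V : X.Opens} (hV : V ≤ interOpen S v) :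
    MvPolynomial (Σ i, N i) R →+* Γ(X, V) :=
  eval₂Hom (baseHom f V) fun j ↦
    X.presheaf.map (homOfLE (le_of_le_interOpen hV j.1)).op ((S j.1).r (v j.1) j.2)

lemma evalHom_C {v : ∀ i, N i} {V : X.Opens} (hV : V ≤ interOpen S v) (a : R) :
    evalHom f hV (C a) = baseHom f V a :=
  eval₂Hom_C _ _ _

lemma evalHom_X {v : ∀ i, N i} {V : X.Opens} (hV : V ≤ interOpen S v) (j : Σ i, N i) :
    evalHom f hV (MvPolynomial.X j) =
      X.presheaf.map (homOfLE (le_of_le_interOpen hV j.1)).op ((S j.1).r (v j.1) j.2) :=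
  eval₂Hom_X' _ _ _

lemma evalHom_X_self {v : ∀ i, N i} {V : X.Opens} (hV : V ≤ interOpen S v) (i : I) :
    evalHom f hV (MvPolynomial.X ⟨i, v i⟩) = 1 := by
  rw [evalHom_X, (S i).r_self, map_one]

lemma map_evalHom {v : ∀ i, N i} {V V' : X.Opens} (hV : V ≤ interOpen S v) (i : V' ⟶ V)
    (p : MvPolynomial (Σ i, N i) R) :
    X.presheaf.map i.op (evalHom f hV p) = evalHom f ((leOfHom i).trans hV) p := by
  change ((X.presheaf.map i.op).hom.comp (evalHom f hV)) p = _
  congr 1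
  refine ringHom_ext (fun a ↦ ?_) fun j ↦ ?_
  · rw [RingHom.comp_apply, evalHom_C, evalHom_C]
    exact map_baseHom f i a
  · rw [RingHom.comp_apply, evalHom_X, evalHom_X]
    change (X.presheaf.map _ ≫ X.presheaf.map i.op) _ = _
    rw [← Functor.map_comp]
    rfl

lemma isUnit_evalHom_X_iff {v : ∀ i, N i} {V : X.Opens} (hV : V ≤ interOpen S v) (j : Σ i, N i) :
    IsUnit (evalHom f hV (MvPolynomial.X j)) ↔ V ≤ (S j.1).U j.2 := by
  rw [evalHom_X, RatioSystem.isUnit_map_r_iff]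

lemma evalHom_X_eq_mul {v w : ∀ i, N i} {V : X.Opens} (hv : V ≤ interOpen S v)
    (hw : V ≤ interOpen S w) (i : I) (u : N i) :
    evalHom f hv (MvPolynomial.X ⟨i, u⟩) = evalHom f hv (MvPolynomial.X ⟨i, w i⟩) * evalHom f hw (MvPolynomial.X ⟨i, u⟩) := by
  rw [evalHom_X, evalHom_X, evalHom_X, (S i).map_mul_map]

section Fintype

variable [Fintype I]

lemma evalHom_blockProd {v : ∀ i, N i} {V : X.Opens} (hV : V ≤ interOpen S v) (w : ∀ i, N i) :
    evalHom f hV (blockProd R w) = ∏ i, evalHom f hV (MvPolynomial.X ⟨i, w i⟩) :=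
  map_prod _ _ _

lemma evalHom_blockProd_self {v : ∀ i, N i} {V : X.Opens} (hV : V ≤ interOpen S v) :
    evalHom f hV (blockProd R v) = 1 := by
  rw [evalHom_blockProd]
  exact Finset.prod_eq_one fun i _ ↦ evalHom_X_self f hV i

lemma isUnit_evalHom_blockProd_iff {v : ∀ i, N i} {V : X.Opens} (hV : V ≤ interOpen S v)
    (w : ∀ i, N i) : IsUnit (evalHom f hV (blockProd R w)) ↔ V ≤ interOpen S w := by
  rw [evalHom_blockProd, IsUnit.prod_univ_iff, interOpen, le_iInf_iff]
  exact forall_congr' fun i ↦ isUnit_evalHom_X_iff f hV ⟨i, w i⟩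

/-- Changing the denominators scales the values of homogeneous polynomials. -/
lemma evalHom_eq_prod_mul {D : Type*} [AddCommGroup D] {e : I → D} (he : LinearIndependent ℤ e)
    [∀ i, Fintype (N i)] {v w : ∀ i, N i}
    {V : X.Opens} (hv : V ≤ interOpen S v) (hw : V ≤ interOpen S w) {d : D}
    {p : MvPolynomial (Σ i, N i) R} (hp : p ∈ weightedHomogeneousSubmodule R (fun j ↦ e j.1) d)
    {β : (Σ i, N i) →₀ ℕ} (hβ : Finsupp.weight (fun j ↦ e j.1) β = d) :
    evalHom f hv p = (∏ i, evalHom f hv (MvPolynomial.X ⟨i, w i⟩) ^ blockDegree β i) * evalHom f hw p := by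
  rw [p.as_sum, map_sum, map_sum, Finset.mul_sum]
  refine Finset.sum_congr rfl fun α hα ↦ ?_
  -- All monomials of `p` have the weight of `β`, hence its block degrees, so they all scale by one
  -- and the same factor.
  have hαβ (i : I) : blockDegree β i = blockDegree α i := by
    have := blockDegree_eq_of_weight_eq he (α := α) (β := β) (c := 0)
      (by simpa [hβ] using hp (mem_support_iff.mp hα)) i
    simpa using this
  simp only [hαβ]
  rw [monomial_eq, map_mul, map_mul, evalHom_C, evalHom_C, Finsupp.prod_fintype _ _ (by simp),
    map_prod, map_prod, mul_left_comm]
  congr 1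
  rw [Fintype.prod_sigma, Fintype.prod_sigma, ← Finset.prod_mul_distrib]
  refine Finset.prod_congr rfl fun i _ ↦ ?_
  rw [blockDegree, ← Finset.prod_pow_eq_pow_sum, ← Finset.prod_mul_distrib]
  refine Finset.prod_congr rfl fun u _ ↦ ?_
  rw [map_pow, map_pow, ← mul_pow, ← evalHom_X_eq_mul]

/-- The scaling factor depends only on the common degree of `p` and `q`, so it cancels from their
quotient. This cross-multiplied form needs no invertibility. -/
lemma evalHom_mul_evalHom_comm {D : Type*} [AddCommGroup D] {e : I → D}
    (he : LinearIndependent ℤ e) [∀ i, Fintype (N i)] {v w : ∀ i, N i}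
    {V : X.Opens} (hv : V ≤ interOpen S v) (hw : V ≤ interOpen S w) {d : D}
    {p q : MvPolynomial (Σ i, N i) R} (hp : p ∈ weightedHomogeneousSubmodule R (fun j ↦ e j.1) d)
    (hq : q ∈ weightedHomogeneousSubmodule R (fun j ↦ e j.1) d) :
    evalHom f hv p * evalHom f hw q = evalHom f hw p * evalHom f hv q := by
  by_cases h0 : q = 0
  · simp [h0]
  obtain ⟨β, hβ⟩ := support_nonempty.mpr h0
  have hβ' := hq (mem_support_iff.mp hβ)
  rw [evalHom_eq_prod_mul f he hv hw hp hβ', evalHom_eq_prod_mul f he hv hw hq hβ']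
  ring

end Fintype

/-- If each of the affine opens `U i (v i)` has its functions generated by the quotients, then so
has their intersection. -/
lemma evalHom_surjective [X.IsSeparated] [Finite I] [Nonempty I] {v : ∀ i, N i}
    (haff : ∀ i, IsAffineOpen ((S i).U (v i)))
    (hgen : ∀ i, letI := (baseHom f ((S i).U (v i))).toAlgebra
      Algebra.adjoin R (Set.range ((S i).r (v i))) = ⊤) :
    IsAffineOpen (interOpen S v) ∧
      Function.Surjective (evalHom f (le_refl (interOpen S v))) := by
  -- The affine opens whose functions restrict into the image of `evalHom`. Separatedness makes this
  -- family stable under intersection, and it contains each `U i (v i)` because the generating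
  -- quotients are values of variables. As `I` is finite and nonempty, it contains `interOpen S v`.
  let 𝒱 : Set X.Opens := {V | IsAffineOpen V ∧ ∀ (h : interOpen S v ≤ V) (a : Γ(X, V)),
    X.presheaf.map (homOfLE h).op a ∈ (evalHom f (le_refl (interOpen S v))).range}
  have hinf : InfClosed 𝒱 := by
    rintro V ⟨hV, hV'⟩ W ⟨hW, hW'⟩
    refine ⟨hV.inf hW, fun h a ↦ ?_⟩
    have hle : Subring.closure (Set.range (X.presheaf.map (homOfLE inf_le_left : V ⊓ W ⟶ V).op) ∪
      Set.range (X.presheaf.map (homOfLE inf_le_right : V ⊓ W ⟶ W).op)) ≤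
      (evalHom f (le_refl (interOpen S v))).range.comap (X.presheaf.map (homOfLE h).op).hom := by
      rw [Subring.closure_le]
      rintro _ (⟨b, rfl⟩ | ⟨b, rfl⟩)
      · have hb := hV' (h.trans inf_le_left) b
        have e : homOfLE (h.trans inf_le_left) = homOfLE h ≫ homOfLE (inf_le_left : V ⊓ W ≤ V) := rfl
        rw [e, op_comp, Functor.map_comp] at hb
        exact hb
      · have hb := hW' (h.trans inf_le_right) b
        have e : homOfLE (h.trans inf_le_right) = homOfLE h ≫ homOfLE (inf_le_right : V ⊓ W ≤ W) := rfl
        rw [e, op_comp, Functor.map_comp] at hb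
        exact hb
    rw [closure_range_union_of_isSeparated hV hW] at hle
    exact hle (Subring.mem_top a)
  have hmem : interOpen S v ∈ 𝒱 := by
    refine InfClosed.iInf_mem_of_nonempty hinf fun i ↦ ⟨haff i, fun h a ↦ ?_⟩
    let := (baseHom f ((S i).U (v i))).toAlgebra
    have ha : a ∈ Algebra.adjoin R (Set.range ((S i).r (v i))) := by rw [hgen i]; trivial
    induction ha using Algebra.adjoin_induction with
    | mem x hx =>
      obtain ⟨u, rfl⟩ := hx
      exact ⟨MvPolynomial.X ⟨i, u⟩, evalHom_X f le_rfl ⟨i, u⟩⟩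
    | algebraMap r => exact ⟨C r, (evalHom_C f le_rfl r).trans (map_baseHom f (homOfLE h) r).symm⟩
    | add x y _ _ hx hy => rw [map_add]; exact add_mem hx hy
    | mul x y _ _ hx hy => rw [map_mul]; exact mul_mem hx hy
  refine ⟨hmem.1, fun a ↦ ?_⟩
  simpa using hmem.2 le_rfl a

end RatioSystem

end MultigradedProj

namespace MultigradedProj

open HomogeneousLocalization SetLike

/-! ### Homomorphisms out of degree-zero localizations -/

section AwayHom

variable {D A : Type u} {σ : Type w} [AddCommGroup D] [CommRing A]
  [SetLike σ A] [AddSubgroupClass σ A] [DecidableEq D] (𝒜 : D → σ) [GradedRing 𝒜]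
  {B C : Type*} [CommRing B] [CommRing C]

/-- The homomorphism from `A_(f)` induced by a homomorphism from `A` that inverts `f`. -/
noncomputable def awayHom (φ : A →+* B) {f : A} (hf : IsUnit (φ f)) : Away 𝒜 f →+* B :=
  (Localization.awayLift φ f hf).comp (algebraMap (Away 𝒜 f) (Localization.Away f))

variable {𝒜}

lemma awayHom_apply (φ : A →+* B) {f : A} (hf : IsUnit (φ f)) (z : Away 𝒜 f) :
    awayHom 𝒜 φ hf z = Localization.awayLift φ f hf z.val := rfl

lemma awayHom_mk_mul (φ : A →+* B) {f : A} (hf : IsUnit (φ f)) {d : D} (hd : f ∈ 𝒜 d) (n : ℕ)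
    {a : A} (ha : a ∈ 𝒜 (n • d)) :
    awayHom 𝒜 φ hf (Away.mk 𝒜 hd n a ha) * φ f ^ n = φ a := by
  have h : (Away.mk 𝒜 hd n a ha).val * algebraMap A _ (f ^ n) = algebraMap A _ a := by
    rw [Away.val_mk, Localization.mk_eq_mk'_apply]
    exact IsLocalization.mk'_spec (M := .powers f) _ a ⟨f ^ n, n, rfl⟩
  have h' := congr(Localization.awayLift φ f hf $h)
  rwa [map_mul, Localization.awayLift, IsLocalization.Away.lift_eq, IsLocalization.Away.lift_eq,
    map_pow] at h'

lemma awayHom_fromZeroRingHom (φ : A →+* B) {f : A} (hf : IsUnit (φ f)) (a : 𝒜 0) :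
    awayHom 𝒜 φ hf (fromZeroRingHom 𝒜 (.powers f) a) = φ a :=
  IsLocalization.Away.lift_eq f hf (a : A)

/-- Numerator and denominator of an element of `A_(f)` have the same degree, so cross-multiplying
identifies the two values. -/
lemma awayHom_congr {φ φ' : A →+* B} {f : A} (hf : IsUnit (φ f)) (hf' : IsUnit (φ' f))
    (hhom : IsHomogeneousElem 𝒜 f)
    (h : ∀ ⦃d : D⦄ ⦃a b : A⦄, a ∈ 𝒜 d → b ∈ 𝒜 d → φ a * φ' b = φ' a * φ b) :
    awayHom 𝒜 φ hf = awayHom 𝒜 φ' hf' := by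
  obtain ⟨d, hd⟩ := hhom
  ext z
  obtain ⟨n, a, ha, rfl⟩ := Away.mk_surjective 𝒜 hd z
  have h1 := h ha (pow_mem_graded n hd)
  rw [← awayHom_mk_mul φ hf hd n ha, ← awayHom_mk_mul φ' hf' hd n ha, map_pow, map_pow,
    mul_assoc, mul_assoc, mul_comm (φ' f ^ n)] at h1
  exact ((hf.pow n).mul (hf'.pow n)).mul_right_cancel h1

lemma awayHom_comp_transition (φ : A →+* B) {x f : RelevantElement 𝒜} (h : x ≤ f)
    (hx : IsUnit (φ x.elt)) (hf : IsUnit (φ f.elt)) :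
    (awayHom 𝒜 φ hx).comp (transition h) = awayHom 𝒜 φ hf := by
  have key : (Localization.awayLift φ x.elt hx).comp (locMap (RelevantElement.dvd h)) =
      Localization.awayLift φ f.elt hf := by
    refine IsLocalization.ringHom_ext (Submonoid.powers f.elt) (RingHom.ext fun a ↦ ?_)
    rw [RingHom.comp_apply, RingHom.comp_apply, locMap_algebraMap, RingHom.comp_apply,
      Localization.awayLift, Localization.awayLift, IsLocalization.Away.lift_eq,
      IsLocalization.Away.lift_eq]
  ext z
  rw [RingHom.comp_apply, awayHom_apply, val_transition, ← RingHom.comp_apply, key, awayHom_apply]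

lemma comp_awayHom (ψ : B →+* C) (φ : A →+* B) {f : A} (hf : IsUnit (φ f))
    (hf' : IsUnit (ψ.comp φ f)) : ψ.comp (awayHom 𝒜 φ hf) = awayHom 𝒜 (ψ.comp φ) hf' := by
  have key : ψ.comp (Localization.awayLift φ f hf) = Localization.awayLift (ψ.comp φ) f hf' := by
    refine IsLocalization.ringHom_ext (Submonoid.powers f) (RingHom.ext fun a ↦ ?_)
    rw [RingHom.comp_apply, RingHom.comp_apply, RingHom.comp_apply, Localization.awayLift,
      Localization.awayLift, IsLocalization.Away.lift_eq, IsLocalization.Away.lift_eq,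
      RingHom.comp_apply]
  rw [awayHom, ← RingHom.comp_assoc, key, awayHom]

end AwayHom

/-! ### The morphism defined by quotients of sections -/

section Morphism

open MvPolynomial

attribute [local instance] MvPolynomial.weightedGradedAlgebra

variable {R D : Type u} [CommRing R] [AddCommGroup D] [DecidableEq D]
  {I : Type} [Fintype I] {N : I → Type} [∀ i, Fintype (N i)] {e : I → D}
  {X : Scheme.{u}} (f : X ⟶ Spec (.of R)) {S : ∀ i, RatioSystem X (N i)}

/-- The morphism to `D₊(g)` given by the quotients of sections. -/
noncomputable def localMor {v : ∀ i, N i} {V : X.Opens} (hV : V ≤ interOpen S v)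
    (g : RelevantElement (weightedHomogeneousSubmodule R fun j : Σ i, N i ↦ e j.1))
    (hg : IsUnit (evalHom f hV g.elt)) :
    V.toScheme ⟶ multiProj (weightedHomogeneousSubmodule R fun j : Σ i, N i ↦ e j.1) :=
  V.toSpecΓ ≫ Spec.map (CommRingCat.ofHom (awayHom _ (evalHom f hV) hg)) ≫ multiProj.ι g

omit [Fintype I] [∀ i, Fintype (N i)] in
lemma localMor_of_le {v : ∀ i, N i} {V : X.Opens} (hV : V ≤ interOpen S v)
    {x g : RelevantElement (weightedHomogeneousSubmodule R fun j : Σ i, N i ↦ e j.1)} (h : x ≤ g)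
    (hx : IsUnit (evalHom f hV x.elt)) (hg : IsUnit (evalHom f hV g.elt)) :
    localMor f hV x hx = localMor f hV g hg := by
  rw [localMor, localMor, ← multiProj.map_ι h, multiProj.map, ← Spec.map_comp_assoc,
    ← CommRingCat.ofHom_comp, awayHom_comp_transition _ h hx hg]

lemma localMor_congr (he : LinearIndependent ℤ e) {v w : ∀ i, N i} {V : X.Opens}
    (hv : V ≤ interOpen S v) (hw : V ≤ interOpen S w)
    (g : RelevantElement (weightedHomogeneousSubmodule R fun j : Σ i, N i ↦ e j.1))
    (hg : IsUnit (evalHom f hv g.elt)) (hg' : IsUnit (evalHom f hw g.elt)) :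
    localMor f hv g hg = localMor f hw g hg' := by
  rw [localMor, localMor, awayHom_congr hg hg' g.relevant.homogeneous fun _ _ _ ha hb ↦
    evalHom_mul_evalHom_comm f he hv hw ha hb]

omit [Fintype I] [∀ i, Fintype (N i)] in
lemma homOfLE_localMor {v : ∀ i, N i} {V V' : X.Opens} (hV : V ≤ interOpen S v) (h : V' ≤ V)
    (g : RelevantElement (weightedHomogeneousSubmodule R fun j : Σ i, N i ↦ e j.1))
    (hg : IsUnit (evalHom f hV g.elt)) (hg' : IsUnit (evalHom f (h.trans hV) g.elt)) :
    X.homOfLE h ≫ localMor f hV g hg = localMor f (h.trans hV) g hg' := by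
  have key : (X.presheaf.map (homOfLE h).op).hom.comp (evalHom f hV) = evalHom f (h.trans hV) :=
    RingHom.ext fun p ↦ map_evalHom f hV (homOfLE h) p
  have key' : (X.presheaf.map (homOfLE h).op).hom.comp (awayHom _ (evalHom f hV) hg) =
      awayHom (weightedHomogeneousSubmodule R fun j : Σ i, N i ↦ e j.1)
        (evalHom f (h.trans hV)) hg' := by
    rw [comp_awayHom _ _ hg (by rwa [key])]
    simp only [key]
  rw [localMor, localMor, ← Scheme.Opens.toSpecΓ_SpecMap_presheaf_map_assoc,
    ← Spec.map_comp_assoc, ← key']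
  rfl

variable (he' : (AddSubgroup.closure (Set.range e)).FiniteIndex)

omit [∀ i, Fintype (N i)] in
lemma isUnit_evalHom_relevantBlockProd_iff {v : ∀ i, N i} {V : X.Opens}
    (hV : V ≤ interOpen S v) (w : ∀ i, N i) :
    IsUnit (evalHom f hV (relevantBlockProd (R := R) he' w).elt) ↔ V ≤ interOpen S w :=
  isUnit_evalHom_blockProd_iff f hV w

variable (S) in
/-- The morphism on `U v` given by the quotients of sections. -/
noncomputable def patchMor (v : ∀ i, N i) : (interOpen S v).toScheme ⟶
    multiProj (weightedHomogeneousSubmodule R fun j : Σ i, N i ↦ e j.1) :=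
  localMor f le_rfl (relevantBlockProd he' v)
    ((isUnit_evalHom_relevantBlockProd_iff f he' le_rfl v).mpr le_rfl)

/-- Both restrictions factor through the chart of `T_v T_w`, which is inverted by either evaluation
on `V`. In this common chart the change of denominators is harmless by `localMor_congr`. -/
lemma homOfLE_patchMor (he : LinearIndependent ℤ e) {v w : ∀ i, N i} {V : X.Opens}
    (hv : V ≤ interOpen S v) (hw : V ≤ interOpen S w) :
    X.homOfLE hv ≫ patchMor f S he' v = X.homOfLE hw ≫ patchMor f S he' w := by
  have h1 {v' : ∀ i, N i} (hv' : V ≤ interOpen S v') :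
      IsUnit (evalHom f hv' (relevantBlockProd (R := R) he' v).elt) :=
    (isUnit_evalHom_relevantBlockProd_iff f he' hv' v).mpr hv
  have h2 {v' : ∀ i, N i} (hv' : V ≤ interOpen S v') :
      IsUnit (evalHom f hv' (relevantBlockProd (R := R) he' w).elt) :=
    (isUnit_evalHom_relevantBlockProd_iff f he' hv' w).mpr hw
  have h3 {v' : ∀ i, N i} (hv' : V ≤ interOpen S v') : IsUnit (evalHom f hv'
      ((relevantBlockProd (R := R) he' v).mul (relevantBlockProd he' w)).elt) := by
    change IsUnit (evalHom f hv' ((relevantBlockProd (R := R) he' v).elt * _))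
    rw [map_mul]
    exact (h1 hv').mul (h2 hv')
  rw [patchMor, patchMor, homOfLE_localMor f le_rfl hv _ _ (h1 hv),
    homOfLE_localMor f le_rfl hw _ _ (h2 hw),
    ← localMor_of_le f hv (RelevantElement.mul_le_left _ _) (h3 hv) (h1 hv),
    ← localMor_of_le f hw (RelevantElement.mul_le_right _ _) (h3 hw) (h2 hw),
    localMor_congr f he hv hw]

variable (S) in
omit [∀ i, Fintype (N i)] in
lemma iSup_interOpen (C : ∀ i, Finset (N i)) (hC : ∀ i, ⨆ v ∈ C i, (S i).U v = ⊤) :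
    ⨆ v : ∀ i, C i, interOpen S (fun i ↦ (v i).1) = ⊤ := by
  refine top_le_iff.mp fun x _ ↦ ?_
  have (i : I) : ∃ v : C i, x ∈ (S i).U v.1 := by
    have hx : x ∈ ⨆ v ∈ C i, (S i).U v := by rw [hC]; trivial
    simp only [TopologicalSpace.Opens.mem_iSup] at hx
    obtain ⟨v, hv, hx⟩ := hx
    exact ⟨⟨v, hv⟩, hx⟩
  choose v hv using this
  refine TopologicalSpace.Opens.mem_iSup.mpr ⟨v, ?_⟩
  rw [interOpen, ← SetLike.mem_coe, TopologicalSpace.Opens.coe_iInf]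
  exact Set.mem_iInter.mpr hv

omit [∀ i, Fintype (N i)] in
lemma isOpenCover_interOpen (C : ∀ i, Finset (N i)) (hC : ∀ i, ⨆ v ∈ C i, (S i).U v = ⊤) :
    TopologicalSpace.IsOpenCover fun v ↦ interOpen S v :=
  top_le_iff.mp ((iSup_interOpen S C hC).ge.trans
    (iSup_le fun v ↦ le_iSup (fun v ↦ interOpen S v) fun i ↦ (v i).1))

variable (S) in
/-- The morphism to the multihomogeneous spectrum of a polynomial ring given by the quotients
of sections. -/
noncomputable def mor (he : LinearIndependent ℤ e) (hS : TopologicalSpace.IsOpenCover fun v ↦ interOpen S v) :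
    X ⟶ multiProj (weightedHomogeneousSubmodule R fun j : Σ i, N i ↦ e j.1) :=
  (X.openCoverOfIsOpenCover (fun v ↦ interOpen S v) hS).glueMorphisms
    (fun v ↦ patchMor f S he' v) fun v w ↦
      (cancel_epi (isPullback_opens_inf (interOpen S v) (interOpen S w)).isoPullback.hom).mp <| ((isPullback_opens_inf _ _).isoPullback_hom_fst_assoc _).trans
        ((homOfLE_patchMor f he' he inf_le_left inf_le_right).trans
          ((isPullback_opens_inf _ _).isoPullback_hom_snd_assoc _).symm)

lemma ι_mor (he : LinearIndependent ℤ e) (hS : TopologicalSpace.IsOpenCover fun v ↦ interOpen S v) (v : ∀ i, N i) :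
    (interOpen S v).ι ≫ mor f S he' he hS = patchMor f S he' v :=
  Scheme.Cover.ι_glueMorphisms (X.openCoverOfIsOpenCover (fun v ↦ interOpen S v) hS) _ _ v

end Morphism

end MultigradedProj

namespace MultigradedProj

open HomogeneousLocalization SetLike

/-! ### The immersion property and the proper case -/

section Immersion

open MvPolynomial

attribute [local instance] MvPolynomial.weightedGradedAlgebra

variable {R D : Type u} [CommRing R] [AddCommGroup D] [DecidableEq D]
  {I : Type} [Fintype I] {N : I → Type} {e : I → D}
  {X : Scheme.{u}} (f : X ⟶ Spec (.of R)) {S : ∀ i, RatioSystem X (N i)}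

lemma basicOpen_evalHom_blockProd (v w : ∀ i, N i) :
    X.basicOpen (evalHom f (le_refl (interOpen S v)) (blockProd R w)) =
      interOpen S v ⊓ interOpen S w := by
  refine le_antisymm (le_inf (X.basicOpen_le _) ?_) ?_
  · have h (a : Γ(X, interOpen S v)) :
        IsUnit (X.presheaf.map (homOfLE (X.basicOpen_le a)).op a) :=
      RingedSpace.isUnit_res_basicOpen _ a
    have h1 := h (evalHom f le_rfl (blockProd R w))
    rw [map_evalHom] at h1
    exact (isUnit_evalHom_blockProd_iff f _ w).mp h1
  · have h1 := X.basicOpen_res (evalHom f (le_refl (interOpen S v)) (blockProd R w))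
      (homOfLE (inf_le_left : interOpen S v ⊓ interOpen S w ≤ _)).op
    have h2 := map_evalHom f (le_refl (interOpen S v))
      (homOfLE (inf_le_left : interOpen S v ⊓ interOpen S w ≤ _)) (blockProd R w)
    rw [h2, X.basicOpen_of_isUnit ((isUnit_evalHom_blockProd_iff f _ w).mpr inf_le_right)] at h1
    exact h1.le.trans inf_le_right

variable (he' : (AddSubgroup.closure (Set.range e)).FiniteIndex)

/-- The denominator `T_v` evaluates to `1` on `U_v`, so `T_w / T_v` and `T_w` have the same value.
-/
lemma awayHom_relevantBlockProd_mk (v w : ∀ i, N i)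
    (h : IsUnit (evalHom f (le_refl (interOpen S v)) (relevantBlockProd (R := R) he' v).elt))
    (hw : blockProd R w ∈ weightedHomogeneousSubmodule R (fun j : Σ i, N i ↦ e j.1)
      (1 • ∑ i, e i)) :
    awayHom (weightedHomogeneousSubmodule R fun j : Σ i, N i ↦ e j.1)
      (evalHom f (le_refl (interOpen S v))) h
      (Away.mk _ (blockProd_mem e v) 1 (blockProd R w) hw) =
      evalHom f (le_refl (interOpen S v)) (blockProd R w) := by
  have := awayHom_mk_mul (evalHom f (le_refl (interOpen S v))) h (blockProd_mem e v) 1 hw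
  change _ * evalHom f (le_refl (interOpen S v)) (blockProd R v) ^ 1 = _ at this
  rwa [evalHom_blockProd_self, one_pow, mul_one] at this

/-- Fractions of degree zero already attain all values: constants have degree zero, and the value of
`T_{i,u}` is that of `T_w / T_v`, where `w` is `v` with its `i`-th entry replaced by `u`. -/
lemma awayHom_evalHom_surjective (v : ∀ i, N i)
    (hv : Function.Surjective (evalHom f (le_refl (interOpen S v))))
    (h : IsUnit (evalHom f (le_refl (interOpen S v)) (relevantBlockProd (R := R) he' v).elt)) :
    Function.Surjective (awayHom (weightedHomogeneousSubmodule R fun j : Σ i, N i ↦ e j.1)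
      (evalHom f (le_refl (interOpen S v))) h) := by
  classical
  suffices ∀ p, evalHom f (le_refl (interOpen S v)) p ∈
      (awayHom (weightedHomogeneousSubmodule R fun j : Σ i, N i ↦ e j.1)
        (evalHom f (le_refl (interOpen S v))) h).range by
    intro a
    obtain ⟨p, rfl⟩ := hv a
    exact this p
  intro p
  induction p using MvPolynomial.induction_on with
  | C a => exact ⟨_, awayHom_fromZeroRingHom _ h
      (algebraMap R (weightedHomogeneousSubmodule R (fun j : Σ i, N i ↦ e j.1) 0) a)⟩
  | add p q hp hq => rw [map_add]; exact add_mem hp hq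
  | mul_X p j hp =>
    rw [map_mul]
    refine mul_mem hp ?_
    have hw := blockProd_mem (R := R) e (Function.update v j.1 j.2)
    rw [← one_smul ℕ (∑ i, e i)] at hw
    refine ⟨_, (awayHom_relevantBlockProd_mk f he' v _ h hw).trans ?_⟩
    rw [evalHom_blockProd, Finset.prod_eq_single j.1, Function.update_self]
    · intro i _ hi
      rw [Function.update_of_ne hi, evalHom_X_self]
    · simp

/-- Inside `D₊(T_v)`, the open `D₊(T_w)` is the basic open of `T_w / T_v`, whose pullback is
invertible exactly on `U_v ⊓ U_w`. -/
lemma patchMor_preimage (v w : ∀ i, N i) :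
    patchMor f S he' v ⁻¹ᵁ (multiProj.ι (relevantBlockProd (R := R) he' w)).opensRange =
      (interOpen S v).ι ⁻¹ᵁ interOpen S w := by
  have hw := blockProd_mem (R := R) e w
  rw [← one_smul ℕ (∑ i, e i)] at hw
  rw [patchMor, localMor, Scheme.Hom.comp_preimage, Scheme.Hom.comp_preimage,
    multiProj.preimage_opensRange_ι,
    multiProj.opensRange_map _ (blockProd_mem e v) 1 hw rfl]
  change (interOpen S v).toSpecΓ ⁻¹ᵁ PrimeSpectrum.basicOpen (awayHom _ _ _ _) = _
  rw [awayHom_relevantBlockProd_mk, Scheme.Opens.toSpecΓ_preimage_basicOpen,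
    basicOpen_evalHom_blockProd, Scheme.Hom.preimage_inf, Scheme.Opens.ι_preimage_self, top_inf_eq]

variable [∀ i, Fintype (N i)] (he : LinearIndependent ℤ e)
  (hS : TopologicalSpace.IsOpenCover fun v ↦ interOpen S v)

/-- Checked on each patch `U_v`. Equality here makes the square of `isPullback_mor` cartesian, so
that the morphism can be studied chart by chart on the target. -/
lemma mor_preimage (w : ∀ i, N i) :
    mor f S he' he hS ⁻¹ᵁ (multiProj.ι (relevantBlockProd (R := R) he' w)).opensRange =
      interOpen S w := by
  have key (v : ∀ i, N i) : (interOpen S v).ι ⁻¹ᵁ (mor f S he' he hS ⁻¹ᵁ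
      (multiProj.ι (relevantBlockProd (R := R) he' w)).opensRange) =
      (interOpen S v).ι ⁻¹ᵁ interOpen S w := by
    rw [← Scheme.Hom.comp_preimage, ι_mor, patchMor_preimage]
  ext x
  obtain ⟨v, hv⟩ := hS.exists_mem x
  exact congr(⟨x, hv⟩ ∈ $(key v)).to_iff

lemma isPullback_mor (w : ∀ i, N i) :
    IsPullback ((interOpen S w).toSpecΓ ≫ Spec.map (CommRingCat.ofHom
      (awayHom (weightedHomogeneousSubmodule R fun j : Σ i, N i ↦ e j.1)
        (evalHom f (le_refl (interOpen S w)))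
        ((isUnit_evalHom_relevantBlockProd_iff f he' le_rfl w).mpr le_rfl)))) (interOpen S w).ι
      (multiProj.ι (relevantBlockProd (R := R) he' w)) (mor f S he' he hS) :=
  IsOpenImmersion.isPullback _ _ _ _ (by rw [ι_mor, Category.assoc]; rfl)
    (by rw [mor_preimage, Scheme.Opens.opensRange_ι])

/-- Up to isomorphism the restriction is `U_w ≅ Spec Γ(U_w) → Spec A_(T_w)`, which comes from a
surjection of rings. -/
lemma isClosedImmersion_mor_restrict (w : ∀ i, N i) (hw : IsAffineOpen (interOpen S w))
    (hsurj : Function.Surjective (evalHom f (le_refl (interOpen S w)))) :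
    IsClosedImmersion
      (mor f S he' he hS ∣_ (multiProj.ι (relevantBlockProd (R := R) he' w)).opensRange) := by
  rw [MorphismProperty.arrow_mk_iso_iff @IsClosedImmersion (morphismRestrictOpensRange _ _),
    ← (isPullback_mor f he' he hS w).flip.isoPullback_inv_snd]
  have : IsClosedImmersion (Spec.map (CommRingCat.ofHom
      (awayHom (weightedHomogeneousSubmodule R fun j : Σ i, N i ↦ e j.1)
        (evalHom f (le_refl (interOpen S w)))
        ((isUnit_evalHom_relevantBlockProd_iff f he' le_rfl w).mpr le_rfl)))) :=
    IsClosedImmersion.spec_of_surjective _ (awayHom_evalHom_surjective f he' w hsurj _)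
  have : IsIso (interOpen S w).toSpecΓ := hw.isoSpec_hom ▸ inferInstance
  infer_instance

/-- The morphism given by the quotients of sections is an immersion if the sections generate
the rings of functions. -/
lemma isImmersion_mor [X.IsSeparated] [Nonempty I] (C : ∀ i, Finset (N i))
    (hC : ∀ i, ⨆ v ∈ C i, (S i).U v = ⊤) (haff : ∀ i, ∀ v ∈ C i, IsAffineOpen ((S i).U v))
    (hgen : ∀ i, ∀ v ∈ C i, letI := (baseHom f ((S i).U v)).toAlgebra
      Algebra.adjoin R (Set.range ((S i).r v)) = ⊤) :
    IsImmersion (mor f S he' he hS) := by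
  have : MorphismProperty.RespectsRight @IsImmersion @IsOpenImmersion :=
    ⟨fun i hi g hg ↦ by
      have : IsOpenImmersion i := hi
      have : IsImmersion g := hg
      exact inferInstanceAs (IsImmersion (g ≫ i))⟩
  -- Only charts indexed by the sets `C i` are controlled. They need not cover the target, but their
  -- union contains the range, which is enough for an immersion.
  refine IsZariskiLocalAtTarget.of_range_subset_iSup (P := @IsImmersion)
    (fun v : ∀ i, C i ↦ (multiProj.ι (relevantBlockProd (R := R) he' fun i ↦ (v i).1)).opensRange)
    ?_ fun v ↦ ?_
  · rintro _ ⟨x, rfl⟩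
    have hx : x ∈ ⨆ v : ∀ i, C i, interOpen S (fun i ↦ (v i).1) := by
      rw [iSup_interOpen S C hC]; trivial
    obtain ⟨v, hv⟩ := TopologicalSpace.Opens.mem_iSup.mp hx
    rw [← mor_preimage f he' he hS] at hv
    exact TopologicalSpace.Opens.mem_iSup.mpr ⟨v, hv⟩
  · obtain ⟨h1, h2⟩ := evalHom_surjective f (v := fun i ↦ (v i).1)
      (fun i ↦ haff i _ (v i).2) (fun i ↦ hgen i _ (v i).2)
    have := isClosedImmersion_mor_restrict f he' he hS _ h1 h2
    infer_instance

lemma mor_toSpec :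
    mor f S he' he hS ≫ multiProj.toSpecZero _ ≫ Spec.map (CommRingCat.ofHom (algebraMap R
      (weightedHomogeneousSubmodule R (fun j : Σ i, N i ↦ e j.1) 0))) = f := by
  refine Scheme.hom_ext_of_forall _ _ fun x ↦ ?_
  obtain ⟨v, hv⟩ := hS.exists_mem x
  refine ⟨_, hv, ?_⟩
  have hu := (isUnit_evalHom_relevantBlockProd_iff f he' (le_refl (interOpen S v)) v).mpr le_rfl
  have key : ((awayHom (weightedHomogeneousSubmodule R fun j : Σ i, N i ↦ e j.1)
      (evalHom f (le_refl (interOpen S v))) hu).comp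
      (fromZeroRingHom _ _)).comp (algebraMap R
      (weightedHomogeneousSubmodule R (fun j : Σ i, N i ↦ e j.1) 0)) =
      baseHom f (interOpen S v) :=
    RingHom.ext fun a ↦ (awayHom_fromZeroRingHom _ hu _).trans (evalHom_C f le_rfl a)
  have hι := ι_mor f he' he hS v
  rw [reassoc_of% hι, patchMor, localMor, Category.assoc, Category.assoc,
    reassoc_of% multiProj.ι_toSpecZero, ← Spec.map_comp, ← Spec.map_comp, ← CommRingCat.ofHom_comp,
    ← CommRingCat.ofHom_comp, ← RingHom.comp_assoc, key, baseHom, CommRingCat.ofHom_hom, Spec.map_comp, Spec.map_comp,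
    Category.assoc, Scheme.Opens.toSpecΓ_SpecMap_presheaf_map_top_assoc]
  have := Scheme.toSpecΓ_naturality f
  rw [← reassoc_of% this]
  simp

/-- A scheme with suitable quotients of sections has an immersion into the multihomogeneous
spectrum of a polynomial ring, which is closed if the scheme is proper. -/
lemma exists_isImmersion (he : LinearIndependent ℤ e)
    (he' : (AddSubgroup.closure (Set.range e)).FiniteIndex) [X.IsSeparated] [Nonempty I] (C : ∀ i, Finset (N i))
    (hC : ∀ i, ⨆ v ∈ C i, (S i).U v = ⊤) (haff : ∀ i, ∀ v ∈ C i, IsAffineOpen ((S i).U v))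
    (hgen : ∀ i, ∀ v ∈ C i, letI := (baseHom f ((S i).U v)).toAlgebra
      Algebra.adjoin R (Set.range ((S i).r v)) = ⊤) :
    ∃ m : X ⟶ multiProj (weightedHomogeneousSubmodule R fun j : Σ i, N i ↦ e j.1),
      m ≫ multiProj.toSpecZero _ ≫ Spec.map (CommRingCat.ofHom (algebraMap R
        (weightedHomogeneousSubmodule R (fun j : Σ i, N i ↦ e j.1) 0))) = f ∧
      IsImmersion m ∧ (IsProper f → IsClosedImmersion m) := by
  have hS := isOpenCover_interOpen (S := S) C hC
  have hmf := mor_toSpec f he' he hS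
  have hm := isImmersion_mor f he' he hS C hC haff hgen
  generalize mor f S he' he hS = m at hmf hm
  refine ⟨m, hmf, hm, fun hf ↦ ?_⟩
  -- Since the target is separated, properness of the composite `f` passes to `m`. Thus `m` has
  -- closed range, and an immersion with closed range is a closed immersion.
  have := isSeparated_multiProj_poly (R := R) (N := N) he he'
  have : IsProper (m ≫ multiProj.toSpecZero _ ≫ Spec.map (CommRingCat.ofHom (algebraMap R
        (weightedHomogeneousSubmodule R (fun j : Σ i, N i ↦ e j.1) 0)))) := hmf ▸ hf
  have : IsProper m := .of_comp m (multiProj.toSpecZero _ ≫ Spec.map (CommRingCat.ofHom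
    (algebraMap R (weightedHomogeneousSubmodule R (fun j : Σ i, N i ↦ e j.1) 0))))
  exact .of_isPreimmersion m m.isClosedMap.isClosed_range

end Immersion

end MultigradedProj

/-! ### Assembly of the main theorem -/

/-- A scheme is separated if finitely many sections of a sheaf of modules have affine
nonvanishing loci that cover it. -/
lemma MultigradedProj.GeneratesAffineCover.isSeparated {R : Type u} [CommRing R] {X : Scheme.{u}}
    {f : X ⟶ Spec (.of R)} {A : X.Modules} {n : ℕ} {s : Fin n → Γ(A, ⊤)}
    (hs : GeneratesAffineCover f s) : X.IsSeparated := by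
  obtain ⟨C, hC, h⟩ := hs
  exact (RatioSystem.ofSections s).isSeparated C hC fun v hv ↦ (h v hv).1

lemma MultigradedProj.GeneratesAffineCover.exists_finset {R : Type u} [CommRing R]
    {X : Scheme.{u}} {f : X ⟶ Spec (.of R)} {A : X.Modules} {n : ℕ} {s : Fin n → Γ(A, ⊤)}
    (hs : GeneratesAffineCover f s) :
    ∃ C : Finset (Fin n), (⨆ v ∈ C, (RatioSystem.ofSections s).U v) = ⊤ ∧
      (∀ v ∈ C, IsAffineOpen ((RatioSystem.ofSections s).U v)) ∧
      ∀ v ∈ C, letI := (baseHom f ((RatioSystem.ofSections s).U v)).toAlgebra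
        Algebra.adjoin R (Set.range ((RatioSystem.ofSections s).r v)) = ⊤ := by
  obtain ⟨C, hC, h⟩ := hs
  refine ⟨C, hC, fun v hv ↦ (h v hv).1, fun v hv ↦ ?_⟩
  have h' := (h v hv).2
  rw [ratios_eq_range] at h'
  exact h'

/-- The definition of `polyProj` uses classical decidable equality on `D`, so the general statement
is instantiated at exactly that instance. -/
lemma MultigradedProj.isSeparated_polyProj {R D : Type u} [CommRing R] [AddCommGroup D] {I : Type}
    [Fintype I] {N : I → Type} [∀ i, Fintype (N i)] {e : I → D} (he : LinearIndependent ℤ e)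
    (he' : (AddSubgroup.closure (Set.range e)).FiniteIndex) :
    (polyProj R fun j : Σ i, N i ↦ e j.1).IsSeparated :=
  @isSeparated_multiProj_poly R D _ _ (Classical.decEq D) _ _ _ _ _ he he'

lemma MultigradedProj.exists_isImmersion_polyProj {R D : Type u} [CommRing R] [AddCommGroup D]
    {I : Type} [Fintype I] [Nonempty I] {N : I → Type} [∀ i, Fintype (N i)] {e : I → D}
    {X : Scheme.{u}} [X.IsSeparated] (f : X ⟶ Spec (.of R)) (he : LinearIndependent ℤ e)
    (he' : (AddSubgroup.closure (Set.range e)).FiniteIndex)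
    {S : ∀ i, RatioSystem X (N i)} (C : ∀ i, Finset (N i))
    (hC : ∀ i, ⨆ v ∈ C i, (S i).U v = ⊤) (haff : ∀ i, ∀ v ∈ C i, IsAffineOpen ((S i).U v))
    (hgen : ∀ i, ∀ v ∈ C i, letI := (baseHom f ((S i).U v)).toAlgebra
      Algebra.adjoin R (Set.range ((S i).r v)) = ⊤) :
    ∃ m : X ⟶ polyProj R fun j : Σ i, N i ↦ e j.1,
      m ≫ polyProj.toSpec R (fun j : Σ i, N i ↦ e j.1) = f ∧
      IsImmersion m ∧ (IsProper f → IsClosedImmersion m) :=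
  @exists_isImmersion R D _ _ (Classical.decEq D) _ _ _ _ _ f _ _ he he' _ _ C hC haff hgen

theorem mainTheorem3 {R : Type u} [CommRing R] [IsNoetherianRing R]
    {X : Scheme.{u}} (f : X ⟶ Spec (.of R)) [LocallyOfFiniteType f] [QuasiCompact f]
    {r : ℕ} (L : Fin r → X.Modules) (hL : ∀ k, MultigradedProj.IsInvertible (L k))
    {D : Type u} [AddCommGroup D] (δ : (Fin r → ℤ) →+ D) (hδ : Function.Surjective δ)
    (ρ : ℕ) (hρ : ρ = Module.finrank ℤ D) (hρ_pos : 0 < ρ)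
    (a : Fin ρ → Fin r → ℤ) (A : Fin ρ → X.Modules)
    (hA : ∀ i, MultigradedProj.IsMonomial L (a i) (A i))
    (hbasis : ∃ b : Module.Basis (Fin ρ) ℚ (ℚ ⊗[ℤ] D), ∀ i, b i = 1 ⊗ₜ[ℤ] δ (a i))
    (n : Fin ρ → ℕ) (s : ∀ i, Fin (n i) → Γ(A i, ⊤))
    (hs : ∀ i, MultigradedProj.GeneratesAffineCover f (s i)) :
    let w : (Σ i : Fin ρ, Fin (n i)) → D := fun j ↦ δ (a j.1)
    (MultigradedProj.polyProj R w).IsSeparated ∧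
    ∃ ι : X ⟶ MultigradedProj.polyProj R w,
      ι ≫ MultigradedProj.polyProj.toSpec R w = f ∧
      IsImmersion ι ∧ (IsProper f → IsClosedImmersion ι) := by
  have : Module.Finite ℤ D := Module.Finite.of_surjective δ.toIntLinearMap hδ
  obtain ⟨b, hb⟩ := hbasis
  have he : LinearIndependent ℤ fun i ↦ δ (a i) :=
    MultigradedProj.linearIndependent_of_basis_tensor b hb
  have he' := MultigradedProj.finiteIndex_closure_of_linearIndependent he
    ((Fintype.card_fin ρ).trans hρ)
  -- One index is enough here: the affine nonvanishing loci of sections of a single `A i` cover `X`.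
  -- Such an index exists because `ρ` is positive.
  have : X.IsSeparated := (hs ⟨0, hρ_pos⟩).isSeparated
  have : Nonempty (Fin ρ) := ⟨⟨0, hρ_pos⟩⟩
  choose C hC haff hgen using fun i ↦ (hs i).exists_finset
  have H1 := MultigradedProj.isSeparated_polyProj (R := R) (N := fun i ↦ Fin (n i)) he he'
  have H2 := MultigradedProj.exists_isImmersion_polyProj f he he' C hC haff hgen
  exact ⟨H1, H2⟩
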